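/- Let $p$ be an odd prime, $m\ge 4$ an even integer, $l\ge 1$ an integer with $\gcd(m,l)=1$, $q=p^m$, $n=q-1$, and let $\alpha$ be a primitive element of $\mathbb{F}_q$. Let $\mathcal{C}_1$ be the cyclic code of length $n$ over $\mathbb{F}_p$ whose parity-check polynomial is $h_1h_2h_3$, where $h_1,h_2,h_3$ are the minimal polynomials over $\mathbb{F}_p$ of $\alpha,\alpha^2,\alpha^{p^l+1}$ (so its generator polynomial is $(x^n-1)/(h_1h_2h_3)$). For a linear code $\mathcal{C}$ let $\mathcal{C}^\perp$ be its dual and $\overline{\mathcal{C}}$ its extension by one further coordinate making the sum of all coordinates $0$. Put $\mathcal{D}=\overline{\mathcal{C}_1^{\perp}}^{\perp}$, a code of length $p^m$; up to a labelling of the coordinates by the elements of $\mathbb{F}_q$, it is $$\mathcal{D}=\{(\mathrm{Tr}(ax^{p^l+1}+bx^2+cx)+h)_{x\in\mathbb{F}_q} : a,b,c\in\mathbb{F}_q,\ h\in\mathbb{F}_p\},$$ where $\mathrm{Tr}$ is the trace from $\mathbb{F}_q$ to $\mathbb{F}_p$. We say that $\mathcal{D}$ holds a $2$-$(p^m,i,\lambda)$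 design if $\mathcal{D}$ has codewords of Hamming weight $i$, $2<i<p^m$, and, for the set $\mathcal{B}$ of the (distinct) supports of all codewords of weight $i$, every set of two coordinates is contained in exactly $\lambda$ members of $\mathcal{B}$. If $m\ge 6$, then $\mathcal{D}$ holds a $2$-$(p^m,i,\lambda)$ design for each of the following nine pairs; if $m=4$, then it does so for each of the first eight: 1. $i=p^m-p^{m-1}$, $\lambda=(p^m-p^{m-1}-1)(p^{2m-1}-p^{2m-2}+2p^{2m-3}-p^{m-2}+1)$; 2. $i=p^m-p^{m-1}+p^{\frac m2}-p^{\frac{m-2}2}$, $\lambda=\dfrac{p^{\frac{m+2}2}\,[p^m-p^{m-1}+p^{\frac{m-2}2}(p-1)-1]\,(p^{\frac m2}+1)(p^m-p^{m-1}-p^{m-2}-p^{\frac m2}+p^{\frac{m-2}2}+1)}{2(p^2-1)}$; 3. $i=p^m-p^{m-1}-p^{\frac m2}+p^{\frac{m-2}2}$, $\lambda=\dfrac{p^{\frac{m+2}2}\,[p^m-p^{m-1}-p^{\frac{m-2}2}(p-1)-1]\,(p^{\frac m2}-1)(p^m-p^{m-1}-p^{m-2}+p^{\frac m2}-p^{\frac{m-2}2}+1)}{2(p^2-1)}$;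 4. $i=p^m-p^{m-1}-p^{\frac{m+2}2}+p^{\frac m2}$, $\lambda=\dfrac{p^{\frac m2-2}(p^{m-2}-1)(p^{\frac m2}-1)(p^m-p^{m-1}-p^{\frac{m+2}2}+p^{\frac m2}-1)}{2(p^2-1)}$; 5. $i=p^m-p^{m-1}+p^{\frac m2-1}$, $\lambda=\dfrac{p^{\frac{m+2}2}(p^m-p^{m-1}+p^{\frac{m-2}2}-1)(p^{\frac m2+1}-p^{\frac m2}+1)(p^m-p^{m-1}-p^{m-2}+p^{\frac m2}-p^{\frac{m-2}2}+1)}{2(p^2-1)}$; 6. $i=p^m-p^{m-1}+p^{\frac m2}$, $\lambda=\dfrac{p^{\frac m2-2}(p^m-p^{m-1}+p^{\frac m2}-1)(p^{\frac m2}-p^{\frac m2-1}+1)(p^{m+2}-p^m+p^{m-1}+p^{\frac m2}-p^{\frac m2-1}-1)}{2(p^2-1)}$; 7. $i=p^m-p^{m-1}-p^{\frac m2-1}$, $\lambda=\dfrac{p^{\frac{m+2}2}(p^m-p^{m-1}-p^{\frac{m-2}2}-1)(p^{\frac m2+1}-p^{\frac m2}-1)(p^m-p^{m-1}-p^{m-2}-p^{\frac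 m2}+p^{\frac{m-2}2}+1)}{2(p^2-1)}$; 8. $i=p^m-p^{m-1}-p^{\frac m2}$, $\lambda=\dfrac{p^{\frac m2-2}(p^m-p^{m-1}-p^{\frac m2}-1)(p^{\frac m2}-p^{\frac m2-1}-1)(p^{m+2}-p^m+p^{m-1}-p^{\frac m2}+p^{\frac m2-1}-1)}{2(p^2-1)}$; 9. $i=p^m-p^{m-1}+p^{\frac m2}(p-1)$, $\lambda=\dfrac{p^{\frac m2-2}(p^{m-2}-1)(p^{\frac m2}+1)\,[p^m-p^{m-1}+p^{\frac m2}(p-1)-1]}{2(p^2-1)}$. -/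

import Mathlib

open Polynomial

noncomputable section

/-- A `t`-`(v, k, lam)` design on the point set `P`, with block set `𝓑` (simple, since `𝓑` is a
set of blocks, and with the usual nontriviality requirement `t < k < v`). -/
structure IsDesign {P : Type*} [Fintype P] (t v k lam : ℕ) (𝓑 : Set (Finset P)) : Prop where
  card_points : Fintype.card P = v
  one_le_t : 1 ≤ t
  t_lt_k : t < k
  k_lt_v : k < v
  card_block : ∀ B ∈ 𝓑, B.card = k
  balanced : ∀ T : Finset P, T.card = t → {B ∈ 𝓑 | T ⊆ B}.ncard = lam

section Codes

variable {K : Type*} [Field K]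

/-- The (Euclidean) dual of a linear code. -/
def dualCode {ι : Type*} [Fintype ι] (C : Submodule K (ι → K)) : Submodule K (ι → K) where
  carrier := {u | ∀ c ∈ C, ∑ i, u i * c i = 0}
  zero_mem' := by simp
  add_mem' := by
    intro a b ha hb c hc
    simp only [Pi.add_apply, add_mul, Finset.sum_add_distrib, ha c hc, hb c hc, add_zero]
  smul_mem' := by
    intro r a ha c hc
    simp only [Pi.smul_apply, smul_eq_mul, mul_assoc, ← Finset.mul_sum, ha c hc, mul_zero]

/-- The cyclic code of length `n` with generator polynomial `g` (a divisor of `X ^ n - 1`):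
the words `(c₀, …, cₙ₋₁)` such that `g` divides `c₀ + c₁ X + ⋯ + cₙ₋₁ X ^ (n - 1)`. -/
def cyclicCode (n : ℕ) (g : K[X]) : Submodule K (Fin n → K) where
  carrier := {c | g ∣ ∑ i : Fin n, C (c i) * X ^ (i : ℕ)}
  zero_mem' := by simp
  add_mem' := by
    intro a b ha hb
    simp only [Set.mem_ofPred_eq, Pi.add_apply, C_add, add_mul, Finset.sum_add_distrib] at *
    exact dvd_add ha hb
  smul_mem' := by
    intro r a ha
    simp only [Set.mem_ofPred_eq, Pi.smul_apply, smul_eq_mul, C_mul, mul_assoc,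
      ← Finset.mul_sum] at *
    exact Dvd.dvd.mul_left ha _

/-- The cyclic code of length `n` with parity-check polynomial `h` (a divisor of `X ^ n - 1`),
i.e. with generator polynomial `(X ^ n - 1) / h`. -/
def cyclicCodeOfParityCheck (n : ℕ) (h : K[X]) : Submodule K (Fin n → K) :=
  cyclicCode n ((X ^ n - 1) / h)

/-- The extended code: a last coordinate is appended so that all coordinates sum to zero. -/
def extendedCode {n : ℕ} (C : Submodule K (Fin n → K)) : Submodule K (Fin (n + 1) → K) where
  carrier := {c | (fun i : Fin n => c i.castSucc) ∈ C ∧ ∑ i, c i = 0}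
  zero_mem' := by
    refine ⟨C.zero_mem, by simp⟩
  add_mem' := by
    rintro a b ⟨ha, ha'⟩ ⟨hb, hb'⟩
    refine ⟨C.add_mem ha hb, ?_⟩
    simp only [Pi.add_apply, Finset.sum_add_distrib, ha', hb', add_zero]
  smul_mem' := by
    rintro r a ⟨ha, ha'⟩
    refine ⟨C.smul_mem r ha, ?_⟩
    simp only [Pi.smul_apply, smul_eq_mul, ← Finset.mul_sum, ha', mul_zero]

/-- The set of the supports of all codewords of Hamming weight `i`. -/
def supportsOfWeight [DecidableEq K] {ι : Type*} [Fintype ι] (C : Submodule K (ι → K)) (i : ℕ) :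
    Set (Finset ι) :=
  {B | ∃ c ∈ C, hammingNorm c = i ∧ B = Finset.univ.filter (fun j => c j ≠ 0)}

/-- The code `C` has codewords of weight `i`, and their supports form a
`t`-`(v, i, lam)` design. The rational numbers `i` and `lam` are in particular natural numbers. -/
def HoldsDesign [DecidableEq K] {ι : Type*} [Fintype ι] (C : Submodule K (ι → K))
    (t v : ℕ) (i lam : ℚ) : Prop :=
  ∃ k r : ℕ, (k : ℚ) = i ∧ (r : ℚ) = lam ∧ (∃ c ∈ C, hammingNorm c = k) ∧
    IsDesign t v k r (supportsOfWeight C k)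

end Codes

section TheCode

variable {F : Type*} [Field F]

/-- The cyclic code `𝒞₁` of length `p ^ m - 1` over the field with `p` elements whose parity-check
polynomial is the product of the minimal polynomials of `α`, `α ^ 2` and `α ^ (p ^ l + 1)`. -/
def codeC₁ (p m l : ℕ) [Fact p.Prime] [Algebra (ZMod p) F] (α : F) :
    Submodule (ZMod p) (Fin (p ^ m - 1) → ZMod p) :=
  cyclicCodeOfParityCheck (p ^ m - 1)
    (minpoly (ZMod p) α * minpoly (ZMod p) (α ^ 2) * minpoly (ZMod p) (α ^ (p ^ l + 1)))

/-- The dual of the extended code of the dual of `𝒞₁`. -/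
def designCode (p m l : ℕ) [Fact p.Prime] [Algebra (ZMod p) F] (α : F) :
    Submodule (ZMod p) (Fin (p ^ m - 1 + 1) → ZMod p) :=
  dualCode (extendedCode (dualCode (codeC₁ p m l α)))

variable (F) in
/-- The words `(Tr (a x ^ (p ^ l + 1) + b x ^ 2 + c x) + h)`, with coordinates indexed by the
elements `x` of `F`. -/
def traceWords (p l : ℕ) [Fact p.Prime] [Algebra (ZMod p) F] : Set (F → ZMod p) :=
  {w | ∃ a b c : F, ∃ h : ZMod p, ∀ x : F,
    w x = Algebra.trace (ZMod p) F (a * x ^ (p ^ l + 1) + b * x ^ 2 + c * x) + h}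

end TheCode

/-- The nine pairs `(i, λ)` (used for even `m ≥ 4`, so that no exponent is truncated). -/
def designParameters (p : ℚ) (m : ℕ) : List (ℚ × ℚ) :=
  [ (p ^ m - p ^ (m - 1),
      (p ^ m - p ^ (m - 1) - 1) *
        (p ^ (2 * m - 1) - p ^ (2 * m - 2) + 2 * p ^ (2 * m - 3) - p ^ (m - 2) + 1)),
    (p ^ m - p ^ (m - 1) + p ^ (m / 2) - p ^ (m / 2 - 1),
      p ^ (m / 2 + 1) * (p ^ m - p ^ (m - 1) + p ^ (m / 2 - 1) * (p - 1) - 1) *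
        (p ^ (m / 2) + 1) *
        (p ^ m - p ^ (m - 1) - p ^ (m - 2) - p ^ (m / 2) + p ^ (m / 2 - 1) + 1) /
        (2 * (p ^ 2 - 1))),
    (p ^ m - p ^ (m - 1) - p ^ (m / 2) + p ^ (m / 2 - 1),
      p ^ (m / 2 + 1) * (p ^ m - p ^ (m - 1) - p ^ (m / 2 - 1) * (p - 1) - 1) *
        (p ^ (m / 2) - 1) *
        (p ^ m - p ^ (m - 1) - p ^ (m - 2) + p ^ (m / 2) - p ^ (m / 2 - 1) + 1) /
        (2 * (p ^ 2 - 1))),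
    (p ^ m - p ^ (m - 1) - p ^ (m / 2 + 1) + p ^ (m / 2),
      p ^ (m / 2 - 2) * (p ^ (m - 2) - 1) * (p ^ (m / 2) - 1) *
        (p ^ m - p ^ (m - 1) - p ^ (m / 2 + 1) + p ^ (m / 2) - 1) /
        (2 * (p ^ 2 - 1))),
    (p ^ m - p ^ (m - 1) + p ^ (m / 2 - 1),
      p ^ (m / 2 + 1) * (p ^ m - p ^ (m - 1) + p ^ (m / 2 - 1) - 1) *
        (p ^ (m / 2 + 1) - p ^ (m / 2) + 1) *
        (p ^ m - p ^ (m - 1) - p ^ (m - 2) + p ^ (m / 2) - p ^ (m / 2 - 1) + 1) /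
        (2 * (p ^ 2 - 1))),
    (p ^ m - p ^ (m - 1) + p ^ (m / 2),
      p ^ (m / 2 - 2) * (p ^ m - p ^ (m - 1) + p ^ (m / 2) - 1) *
        (p ^ (m / 2) - p ^ (m / 2 - 1) + 1) *
        (p ^ (m + 2) - p ^ m + p ^ (m - 1) + p ^ (m / 2) - p ^ (m / 2 - 1) - 1) /
        (2 * (p ^ 2 - 1))),
    (p ^ m - p ^ (m - 1) - p ^ (m / 2 - 1),
      p ^ (m / 2 + 1) * (p ^ m - p ^ (m - 1) - p ^ (m / 2 - 1) - 1) *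
        (p ^ (m / 2 + 1) - p ^ (m / 2) - 1) *
        (p ^ m - p ^ (m - 1) - p ^ (m - 2) - p ^ (m / 2) + p ^ (m / 2 - 1) + 1) /
        (2 * (p ^ 2 - 1))),
    (p ^ m - p ^ (m - 1) - p ^ (m / 2),
      p ^ (m / 2 - 2) * (p ^ m - p ^ (m - 1) - p ^ (m / 2) - 1) *
        (p ^ (m / 2) - p ^ (m / 2 - 1) - 1) *
        (p ^ (m + 2) - p ^ m + p ^ (m - 1) - p ^ (m / 2) + p ^ (m / 2 - 1) - 1) /
        (2 * (p ^ 2 - 1))),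
    (p ^ m - p ^ (m - 1) + p ^ (m / 2) * (p - 1),
      p ^ (m / 2 - 2) * (p ^ (m - 2) - 1) * (p ^ (m / 2) + 1) *
        (p ^ m - p ^ (m - 1) + p ^ (m / 2) * (p - 1) - 1) /
        (2 * (p ^ 2 - 1))) ]

end

/-! A word of the code is `Q(x) + Tr(c x) + h`, where `Q(x) = Tr(a x σ(x) + b x ^ 2)` is a quadratic
form over the prime field and `σ(x) = x ^ p ^ l`. Write `q = p ^ m`, `m = 2 n`.

Designs. The code is invariant under the maps `x ↦ r x + s` with `r ≠ 0`, which are doubly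
transitive on the coordinates. Hence the supports of the words of a given weight form a 2-design,
and `λ` follows from the number of supports by double counting. That number is the number of words
divided by `p - 1`, because words with equal supports are proportional: otherwise the words `c' - μ
c` with `μ ≠ 0` would together have too many zeros (`exists_eq_smul_of_card_zeros_le`). For `m = 4`
this inequality fails at the ninth pair, which is why that pair needs `m ≥ 6`.

Weights. The radical of `Q` is the solution space of a second-order `σ`-linear equation, and `gcd(m,
l) = 1` makes the fixed field of `σ` the prime field, so a nonzero `(a, b)` gives corank at most 2
(`finrank_ker_polarMap_le`). Diagonalisation and Gauss sums leave six kinds of forms, a corank and a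
sign. If `c` lies in the range of the polar map, completing the square expresses the number of zeros
through the kind and a shifted constant; otherwise that number is `q / p`.

Frequencies. The six numbers of forms of each kind satisfy linear equations given by power moments
of the exponential sums (`kindCount_eq`). By orthogonality each moment counts the solutions of a
small system over the field, which is solved using the fixed field of `σ`.

Trace description. Dualising, extending and dualising again adjoins a zero coordinate and the
constant words (`mem_dualCode_extendedCode_dualCode`), and Delsarte duality turns the cyclic code
into a trace code (`cyclicCodeOfParityCheck_eq_traceCode`). -/

noncomputable section

set_option linter.unusedSectionVars false

open Finset

/-! ### Quadratic Gauss sums and exponential sums of quadratic forms -/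

section GaussSums

variable (p : ℕ) [Fact p.Prime]

/-- The quadratic character of `ZMod p`, with complex values. -/
def quadCharC : MulChar (ZMod p) ℂ := (quadraticChar (ZMod p)).ringHomComp (Int.castRingHom ℂ)

/-- The quadratic Gauss sum of `ZMod p`. -/
def quadGauss : ℂ := gaussSum (quadCharC p) (ZMod.stdAddChar (N := p))

variable {p}

lemma quadCharC_apply (x : ZMod p) : quadCharC p x = (quadraticChar (ZMod p) x : ℂ) := rfl

lemma ringChar_zmod_ne_two (hp : p ≠ 2) : ringChar (ZMod p) ≠ 2 := by
  rwa [ZMod.ringChar_zmod_n]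

lemma quadCharC_ne_one (hp : p ≠ 2) : quadCharC p ≠ 1 :=
  (MulChar.ringHomComp_ne_one_iff (RingHom.injective_int _)).mpr
    (quadraticChar_ne_one (ringChar_zmod_ne_two hp))

lemma quadCharC_isQuadratic : (quadCharC p).IsQuadratic :=
  (quadraticChar_isQuadratic (ZMod p)).comp _

lemma quadCharC_sq {x : ZMod p} (hx : x ≠ 0) : quadCharC p x ^ 2 = 1 := by
  rw [quadCharC_apply]; exact_mod_cast quadraticChar_sq_one hx

lemma quadGauss_sq (hp : p ≠ 2) : quadGauss p ^ 2 = quadCharC p (-1) * p := by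
  have := gaussSum_sq (quadCharC_ne_one hp) quadCharC_isQuadratic (ZMod.isPrimitive_stdAddChar p)
  rw [ZMod.card] at this
  exact this

lemma quadGauss_ne_zero (hp : p ≠ 2) : quadGauss p ≠ 0 := by
  intro h
  have h2 := quadGauss_sq hp
  have hp0 : (p : ℂ) ≠ 0 := by exact_mod_cast (Fact.out : p.Prime).ne_zero
  have := quadCharC_sq (p := p) (x := -1) (by simp)
  rw [h] at h2
  have h3 : quadCharC p (-1) = 0 := by simpa [hp0] using h2.symm
  simp [h3] at this

lemma sum_quadCharC_mul_stdAddChar (hp : p ≠ 2) (h : ZMod p) :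
    ∑ y : ZMod p, quadCharC p y * ZMod.stdAddChar (y * h) = quadCharC p h * quadGauss p := by
  rcases eq_or_ne h 0 with rfl | hh
  · simp [MulChar.sum_eq_zero_of_ne_one (quadCharC_ne_one hp), MulChar.map_zero]
  · have := gaussSum_mulShift (quadCharC p) (ZMod.stdAddChar (N := p)) (Units.mk0 h hh)
    have h2 := quadCharC_sq hh
    rw [quadGauss, ← this, ← mul_assoc]
    simp only [Units.val_mk0, ← sq, h2, one_mul, gaussSum, AddChar.mulShift_apply]
    exact sum_congr rfl fun y _ => by rw [mul_comm h]

lemma sum_stdAddChar_mul (h : ZMod p) :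
    ∑ y : ZMod p, ZMod.stdAddChar (y * h) = if h = 0 then (p : ℂ) else 0 := by
  have := AddChar.sum_mulShift (ψ := ZMod.stdAddChar (N := p)) h (ZMod.isPrimitive_stdAddChar p)
  rw [this]; split_ifs <;> simp [ZMod.card]

/-- An element `t` has `χ(t) + 1` square roots, and the summand 1 contributes nothing because `t ↦
ψ(w t)` is nontrivial. -/
lemma sum_stdAddChar_mul_sq (hp : p ≠ 2) {w : ZMod p} (hw : w ≠ 0) :
    ∑ x : ZMod p, ZMod.stdAddChar (w * x ^ 2) = quadCharC p w * quadGauss p := by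
  have h1 : ∑ x : ZMod p, ZMod.stdAddChar (w * x ^ 2) =
      ∑ t : ZMod p, ((quadraticChar (ZMod p) t + 1 : ℤ) : ℂ) * ZMod.stdAddChar (w * t) := by
    rw [← sum_fiberwise (s := univ) (g := fun x : ZMod p => x ^ 2)]
    refine sum_congr rfl fun t _ => ?_
    rw [← quadraticChar_card_sqrts (ringChar_zmod_ne_two hp) t,
      sum_congr rfl (g := fun _ => ZMod.stdAddChar (w * t))
        (fun x hx => by rw [(mem_filter.mp hx).2]), sum_const, nsmul_eq_mul]
    congr 2
    refine congrArg card ?_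
    ext x; simp
  rw [h1]
  simp only [Int.cast_add, Int.cast_one, add_mul, one_mul, sum_add_distrib]
  have h2 := sum_stdAddChar_mul (p := p) w
  have h3 := sum_quadCharC_mul_stdAddChar hp w
  simp only [mul_comm w] 
  rw [h2, if_neg hw, add_zero, ← h3]
  rfl

lemma AddChar.map_finsetSum {A M ι : Type*} [AddCommMonoid A] [CommMonoid M] (ψ : AddChar A M)
    (s : Finset ι) (f : ι → A) : ψ (∑ i ∈ s, f i) = ∏ i ∈ s, ψ (f i) := by
  classical
  induction s using Finset.induction_on with
  | empty => simp
  | insert a s ha ih => rw [sum_insert ha, prod_insert ha, AddChar.map_add_eq_mul, ih]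

/-- Exponential sums of the multiples of a quadratic form over a prime field. -/
theorem exists_sum_stdAddChar_quadraticForm (hp : p ≠ 2) {V : Type*} [AddCommGroup V]
    [Module (ZMod p) V] [Fintype V] (Q : QuadraticForm (ZMod p) V) :
    ∃ k ≤ Module.finrank (ZMod p) V, ∃ ε : ℤˣ, ∀ y : ZMod p, y ≠ 0 →
      ∑ x, ZMod.stdAddChar (y * Q x) = quadCharC p y ^ (Module.finrank (ZMod p) V - k) *
        ((ε : ℤ) : ℂ) * p ^ k * quadGauss p ^ (Module.finrank (ZMod p) V - k) := by
  have : Invertible (2 : ZMod p) := invertibleOfNonzero (by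
    intro h
    have h2 : ((2 : ℕ) : ZMod p) = 0 := by exact_mod_cast h
    rw [ZMod.natCast_eq_zero_iff] at h2
    exact hp ((Nat.prime_dvd_prime_iff_eq Fact.out Nat.prime_two).mp h2))
  obtain ⟨w, ⟨e⟩⟩ := Q.equivalent_weightedSumSquares
  have key : ∀ y : ZMod p, ∑ x, ZMod.stdAddChar (y * Q x) =
      ∏ i, ∑ t : ZMod p, (ZMod.stdAddChar (y * w i * t ^ 2) : ℂ) := by
    intro y
    rw [Finset.prod_univ_sum, Fintype.piFinset_univ]
    refine Fintype.sum_equiv e.toLinearEquiv.toEquiv _ _ fun x => ?_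
    have : Q x = ∑ i, w i * (e x i) ^ 2 := by
      rw [← e.map_app, QuadraticMap.weightedSumSquares_apply]
      exact sum_congr rfl fun i _ => by rw [smul_eq_mul, sq]
    rw [this, mul_sum, AddChar.map_finsetSum]
    exact prod_congr rfl fun i _ => by rw [mul_assoc]; rfl
  -- In a diagonal form a zero weight contributes the factor `p` and a nonzero weight `w i` the
  -- factor `χ(y) χ(w i) G`. So `k` counts the zero weights and `ε` is the product of the other `χ(w
  -- i)`.
  let s := univ.filter fun i => w i = 0
  have hs : #(univ.filter fun i => ¬ w i = 0) = Module.finrank (ZMod p) V - #s := by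
    have := card_filter_add_card_filter_not (s := (univ : Finset (Fin (Module.finrank (ZMod p) V)))) (fun i => w i = 0)
    simp only [card_univ, Fintype.card_fin] at this
    exact (Nat.sub_eq_of_eq_add' this.symm).symm
  let c : ℤ := ∏ i ∈ univ.filter (fun i => ¬ w i = 0), quadraticChar (ZMod p) (w i)
  have hc : IsUnit c := by
    refine IsUnit.prod_iff.mpr fun i hi => Int.isUnit_iff.mpr ?_
    exact quadraticChar_dichotomy (mem_filter.mp hi).2
  refine ⟨#s, (card_le_univ s).trans (by simp), hc.unit, fun y hy => ?_⟩
  rw [key, ← prod_filter_mul_prod_filter_not univ (fun i => w i = 0),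
    prod_congr rfl (g := fun _ => (p : ℂ)) (fun i hi => by
      simp [(mem_filter.mp hi).2, ZMod.card]),
    prod_congr rfl (s₁ := univ.filter fun i => ¬ w i = 0)
      (g := fun i => quadCharC p y * quadGauss p * quadraticChar (ZMod p) (w i)) (fun i hi => by
      rw [sum_stdAddChar_mul_sq hp (mul_ne_zero hy (mem_filter.mp hi).2), map_mul,
        quadCharC_apply (w i)]; ring),
    prod_const, prod_mul_distrib, prod_const, hs, mul_pow]
  simp only [IsUnit.unit_spec, c, Int.cast_prod]
  ring

end GaussSums

/-! ### The quadratic forms, their polar maps and their exponential sums -/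

section FrobForms

variable {p : ℕ} [Fact p.Prime] {F : Type*} [Field F] [Fintype F] [Algebra (ZMod p) F]

variable (p F) in
/-- The canonical additive character of a finite field of characteristic `p`. -/
def traceChar : AddChar F ℂ :=
  (ZMod.stdAddChar (N := p)).compAddMonoidHom (Algebra.trace (ZMod p) F).toAddMonoidHom

lemma traceChar_apply (x : F) :
    traceChar p F x = ZMod.stdAddChar (Algebra.trace (ZMod p) F x) := rfl

/-- This is the nondegeneracy of the trace form together with the injectivity of `stdAddChar`. -/
lemma traceChar_isPrimitive : (traceChar p F).IsPrimitive := by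
  have : CharP F p := charP_of_injective_algebraMap (algebraMap (ZMod p) F).injective p
  intro a ha h
  obtain ⟨b, hb⟩ : ∃ b : F, Algebra.trace (ZMod p) F (a * b) ≠ 0 := by
    by_contra! hb
    exact ha ((traceForm_nondegenerate (ZMod p) F).1 a hb)
  have h1 : (ZMod.stdAddChar (N := p)) (Algebra.trace (ZMod p) F (a * b)) = 1 := by
    have := DFunLike.congr_fun h b
    simpa [AddChar.mulShift_apply, traceChar_apply] using this
  exact hb (ZMod.injective_stdAddChar (by rw [h1, AddChar.map_zero_eq_one]))

lemma sum_traceChar_mul [DecidableEq F] (b : F) :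
    ∑ a : F, traceChar p F (a * b) = if b = 0 then (Fintype.card F : ℂ) else 0 := by
  rw [AddChar.sum_mulShift b traceChar_isPrimitive]
  split_ifs <;> simp

/-- The linear map whose associated bilinear form is the polar form of
`x ↦ tr (a * (x * σ x) + b * x ^ 2)`. -/
def polarMap (σ : F ≃ₐ[ZMod p] F) (a b : F) : F →ₗ[ZMod p] F :=
  σ.symm.toLinearMap ∘ₗ LinearMap.mulLeft (ZMod p) a + LinearMap.mulLeft (ZMod p) a ∘ₗ σ.toLinearMap
    + LinearMap.mulLeft (ZMod p) (2 * b)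

variable (σ : F ≃ₐ[ZMod p] F)

lemma polarMap_apply (a b z : F) :
    polarMap σ a b z = σ.symm (a * z) + a * σ z + 2 * b * z := rfl

lemma polarMap_smul (a b z : F) (y : ZMod p) :
    polarMap σ (y • a) (y • b) z = y • polarMap σ a b z := by
  simp only [polarMap_apply, smul_mul_assoc, map_smul, smul_add, mul_smul_comm]

/-- The quadratic form `x ↦ tr (a * (x * σ x) + b * x ^ 2)`. -/
def frobForm (a b : F) : QuadraticForm (ZMod p) F :=
  LinearMap.BilinMap.toQuadraticMap
    ((LinearMap.mul (ZMod p) F).compr₂ (Algebra.trace (ZMod p) F) ∘ₗ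
        LinearMap.mulLeft (ZMod p) a |>.compl₂ σ.toLinearMap) +
  LinearMap.BilinMap.toQuadraticMap
    ((LinearMap.mul (ZMod p) F).compr₂ (Algebra.trace (ZMod p) F) ∘ₗ LinearMap.mulLeft (ZMod p) b)

lemma frobForm_apply (a b x : F) :
    frobForm σ a b x = Algebra.trace (ZMod p) F (a * (x * σ x) + b * x ^ 2) := by
  rw [map_add, ← mul_assoc, sq, ← mul_assoc]
  rfl

lemma frobForm_smul (a b x : F) (y : ZMod p) :
    frobForm σ (y • a) (y • b) x = y * frobForm σ a b x := by
  simp only [frobForm_apply, smul_mul_assoc, ← smul_add, map_smul, smul_eq_mul]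

lemma trace_apply_algEquiv (x : F) :
    Algebra.trace (ZMod p) F (σ x) = Algebra.trace (ZMod p) F x :=
  Algebra.trace_eq_of_algEquiv σ x

/-- Invariance of the trace under `σ` moves `σ` off `y`; this is where `σ.symm` in `polarMap` comes
from. -/
lemma frobForm_add (a b x y : F) :
    frobForm σ a b (x + y) = frobForm σ a b x + frobForm σ a b y +
      Algebra.trace (ZMod p) F (y * polarMap σ a b x) := by
  have h : Algebra.trace (ZMod p) F (y * σ.symm (a * x)) =
      Algebra.trace (ZMod p) F (a * (x * σ y)) := by
    rw [← trace_apply_algEquiv σ, map_mul, AlgEquiv.apply_symm_apply]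
    congr 1; ring
  simp only [frobForm_apply, polarMap_apply, mul_add, map_add, h]
  simp only [← map_add]
  congr 1
  ring

/-- Twice the form at `z` is its polar form at `(z, z)`, and `p` is odd. -/
lemma frobForm_eq_zero_of_mem_ker (hp : p ≠ 2) {a b z : F} (hz : polarMap σ a b z = 0) :
    frobForm σ a b z = 0 := by
  have h := frobForm_add σ a b z z
  have h2 : (2 : ZMod p) ≠ 0 := by
    intro h
    have h2 : ((2 : ℕ) : ZMod p) = 0 := by exact_mod_cast h
    rw [ZMod.natCast_eq_zero_iff] at h2
    exact hp ((Nat.prime_dvd_prime_iff_eq Fact.out Nat.prime_two).mp h2)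
  rw [hz, mul_zero, map_zero, add_zero, ← two_smul (ZMod p) z, QuadraticMap.map_smul,
    smul_eq_mul] at h
  have : (2 : ZMod p) * frobForm σ a b z = 0 := by linear_combination h
  exact (mul_eq_zero.mp this).resolve_left h2

/-- The exponential sum attached to `x ↦ a * (x * σ x) + b * x ^ 2 + c * x`. -/
def expSum (a b c : F) : ℂ :=
  ∑ x : F, traceChar p F (a * (x * σ x) + b * x ^ 2 + c * x)

lemma expSum_eq (a b c : F) : expSum σ a b c =
    ∑ x : F, ZMod.stdAddChar (frobForm σ a b x) * traceChar p F (c * x) := by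
  refine sum_congr rfl fun x _ => ?_
  rw [AddChar.map_add_eq_mul, traceChar_apply, frobForm_apply]

lemma expSum_zero_right (a b : F) : expSum σ a b 0 =
    ∑ x : F, ZMod.stdAddChar (frobForm σ a b x) := by
  simp [expSum_eq]

lemma exists_expSum_smul (hp : p ≠ 2) {m : ℕ} (hF : Fintype.card F = p ^ m) (a b : F) :
    ∃ k ≤ m, ∃ ε : ℤˣ, ∀ y : ZMod p, y ≠ 0 → expSum σ (y • a) (y • b) 0 =
      quadCharC p y ^ (m - k) * ((ε : ℤ) : ℂ) * p ^ k * quadGauss p ^ (m - k) := by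
  have hm : Module.finrank (ZMod p) F = m := by
    have := Module.card_eq_pow_finrank (K := ZMod p) (V := F)
    rw [hF, ZMod.card] at this
    exact (Nat.pow_right_injective (Fact.out : p.Prime).two_le this).symm
  obtain ⟨k, hk, ε, h⟩ := exists_sum_stdAddChar_quadraticForm hp (frobForm σ a b)
  rw [hm] at hk h
  refine ⟨k, hk, ε, fun y hy => ?_⟩
  rw [expSum_zero_right, ← h y hy]
  exact sum_congr rfl fun x _ => by rw [frobForm_smul]

/-- Completing the square: the translation by `z` absorbs the linear term. -/
lemma expSum_polarMap (a b z : F) : expSum σ a b (polarMap σ a b z) =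
    ZMod.stdAddChar (- frobForm σ a b z) * expSum σ a b 0 := by
  rw [expSum_eq, expSum_zero_right, mul_sum,
    ← Equiv.sum_comp (Equiv.addLeft z) (fun x => _ * ZMod.stdAddChar (frobForm σ a b x))]
  refine sum_congr rfl fun x _ => ?_
  rw [Equiv.coe_addLeft, frobForm_add, traceChar_apply, mul_comm x, ← AddChar.map_add_eq_mul,
    ← AddChar.map_add_eq_mul]
  congr 1; ring

/-- The product of `expSum σ a b 0` with its conjugate. -/
lemma expSum_mul_expSum_neg (hp : p ≠ 2) (a b : F) :
    expSum σ a b 0 * expSum σ (-a) (-b) 0 =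
      Fintype.card F * Nat.card (LinearMap.ker (polarMap σ a b)) := by
  classical
  have hneg : ∀ x, frobForm σ (-a) (-b) x = - frobForm σ a b x := fun x => by
    have := frobForm_smul σ a b x (-1)
    simpa using this
  have h1 : expSum σ a b 0 * expSum σ (-a) (-b) 0 = ∑ z : F, ∑ y : F,
      ZMod.stdAddChar (frobForm σ a b z) * traceChar p F (y * polarMap σ a b z) := by
    rw [expSum_zero_right, expSum_zero_right, sum_mul_sum, sum_comm]
    symm
    rw [sum_comm]
    symm
    refine sum_congr rfl fun y _ => ?_
    -- With first variable `z + y`, the difference `Q(z + y) - Q(y)` involves `y` only through `Tr(y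
    -- * polarMap z)`. The sum over `y` therefore detects the kernel, on which `Q` vanishes.
    rw [← Equiv.sum_comp (Equiv.addRight y)]
    refine sum_congr rfl fun z _ => ?_
    rw [hneg, ← AddChar.map_add_eq_mul, Equiv.coe_addRight, frobForm_add, traceChar_apply,
      ← AddChar.map_add_eq_mul]
    congr 1; ring
  rw [h1, Nat.card_eq_fintype_card, Fintype.card_subtype]
  simp_rw [← mul_sum, sum_traceChar_mul, LinearMap.mem_ker]
  rw [card_eq_sum_ones, Nat.cast_sum, mul_sum, sum_filter]
  refine sum_congr rfl fun z _ => ?_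
  split_ifs with hz
  · simp [frobForm_eq_zero_of_mem_ker σ hp hz]
  · simp

lemma card_range_mul_card_ker (a b : F) : Nat.card (LinearMap.range (polarMap σ a b)) *
    Nat.card (LinearMap.ker (polarMap σ a b)) = Fintype.card F := by
  rw [← Nat.card_eq_fintype_card,
    Submodule.card_eq_card_quotient_mul_card (LinearMap.ker (polarMap σ a b)),
    Nat.card_congr (polarMap σ a b).quotKerEquivRange.toEquiv, mul_comm]

/-- Twisting by a linear form outside of the image of the polar map kills the exponential sum. -/
lemma expSum_eq_zero_of_notMem_range (hp : p ≠ 2) {a b c : F}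
    (hc : c ∉ LinearMap.range (polarMap σ a b)) : expSum σ a b c = 0 := by
  classical
  have hconj : ∀ c, starRingEnd ℂ (expSum σ a b c) = ∑ x, ZMod.stdAddChar (- frobForm σ a b x) *
      traceChar p F (- (c * x)) := fun c => by
    rw [expSum_eq, map_sum]
    refine sum_congr rfl fun x _ => ?_
    rw [map_mul, AddChar.map_neg_eq_conj, AddChar.map_neg_eq_conj]
  have hneg : ∀ x, frobForm σ (-a) (-b) x = - frobForm σ a b x := fun x => by
    have := frobForm_smul σ a b x (-1)
    simpa using this
  -- Parseval over all `c`. The range of the polar map already accounts for this whole total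
  -- (`hrange`), so the nonnegative terms outside it vanish.
  have hpars : ∑ c, expSum σ a b c * starRingEnd ℂ (expSum σ a b c) = (Fintype.card F : ℂ) ^ 2 := by
    have : ∀ x y : F, ∑ c : F, ZMod.stdAddChar (frobForm σ a b x) * traceChar p F (c * x) *
        (ZMod.stdAddChar (-frobForm σ a b y) * traceChar p F (-(c * y))) =
        if x = y then (Fintype.card F : ℂ) else 0 := by
      intro x y
      have h2 := sum_traceChar_mul (p := p) (x - y)
      simp only [sub_eq_zero] at h2
      have h3 : ∀ c : F, ZMod.stdAddChar (frobForm σ a b x) * traceChar p F (c * x) *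
          (ZMod.stdAddChar (-frobForm σ a b y) * traceChar p F (-(c * y))) =
          ZMod.stdAddChar (frobForm σ a b x) * ZMod.stdAddChar (-frobForm σ a b y) *
            traceChar p F (c * (x - y)) := fun c => by
        rw [mul_sub, sub_eq_add_neg (c * x), AddChar.map_add_eq_mul]; ring
      simp_rw [h3, ← mul_sum, h2]
      split_ifs with h
      · rw [h, ← AddChar.map_add_eq_mul, add_neg_cancel, AddChar.map_zero_eq_one, one_mul]
      · rw [mul_zero]
    simp_rw [hconj, expSum_eq, sum_mul_sum]
    rw [sum_comm]
    calc _ = ∑ x : F, ∑ y : F, if x = y then (Fintype.card F : ℂ) else 0 := by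
          refine sum_congr rfl fun x _ => ?_
          rw [sum_comm]
          exact sum_congr rfl fun y _ => this x y
      _ = _ := by simp [sq]
  -- By `expSum_polarMap` all `c` in the range give the same absolute square, `card F * card ker`,
  -- and the range has `card F / card ker` elements.
  have hrange : ∑ c ∈ univ.filter (· ∈ LinearMap.range (polarMap σ a b)),
      expSum σ a b c * starRingEnd ℂ (expSum σ a b c) = (Fintype.card F : ℂ) ^ 2 := by
    have h0 : expSum σ a b 0 * starRingEnd ℂ (expSum σ a b 0) =
        Fintype.card F * Nat.card (LinearMap.ker (polarMap σ a b)) := by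
      rw [← expSum_mul_expSum_neg σ hp, hconj, expSum_zero_right σ (-a)]
      simp [hneg]
    have h1 : ∀ c ∈ univ.filter (· ∈ LinearMap.range (polarMap σ a b)),
        expSum σ a b c * starRingEnd ℂ (expSum σ a b c) =
          Fintype.card F * Nat.card (LinearMap.ker (polarMap σ a b)) := by
      intro c hc
      obtain ⟨z, rfl⟩ := (mem_filter.mp hc).2
      have h2 : (ZMod.stdAddChar (-frobForm σ a b z) : ℂ) *
          starRingEnd ℂ (ZMod.stdAddChar (-frobForm σ a b z)) = 1 := by
        rw [← AddChar.map_neg_eq_conj, ← AddChar.map_add_eq_mul, add_neg_cancel,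
          AddChar.map_zero_eq_one]
      rw [expSum_polarMap, map_mul, ← h0]
      linear_combination expSum σ a b 0 * starRingEnd ℂ (expSum σ a b 0) * h2
    rw [sum_congr rfl h1, sum_const, nsmul_eq_mul]
    have h2 : Fintype.card F = #(univ.filter (· ∈ LinearMap.range (polarMap σ a b))) *
        Nat.card (LinearMap.ker (polarMap σ a b)) := by
      rw [← card_range_mul_card_ker σ a b, Nat.card_eq_fintype_card, Fintype.card_subtype]
    have h3 := congrArg (Nat.cast (R := ℂ)) h2
    push_cast at h3 ⊢
    linear_combination - (Fintype.card F : ℂ) * h3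
  have hnorm : ∀ c, expSum σ a b c * starRingEnd ℂ (expSum σ a b c) =
      ((Complex.normSq (expSum σ a b c) : ℝ) : ℂ) := fun c => Complex.mul_conj _
  simp_rw [hnorm] at hpars hrange
  rw [← sum_filter_add_sum_filter_not univ (· ∈ LinearMap.range (polarMap σ a b)), hrange,
    add_eq_left] at hpars
  have h0 : ∑ c ∈ univ.filter (fun c => ¬ c ∈ LinearMap.range (polarMap σ a b)),
      Complex.normSq (expSum σ a b c) = 0 := by exact_mod_cast hpars
  rw [sum_eq_zero_iff_of_nonneg fun _ _ => Complex.normSq_nonneg _] at h0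
  exact Complex.normSq_eq_zero.mp (h0 c (by simp [-LinearMap.mem_range, hc]))

end FrobForms

/-! ### The corank is at most two -/

section Kernel

variable {p : ℕ} [Fact p.Prime] {F : Type*} [Field F] [Fintype F] [Algebra (ZMod p) F]
  (σ : F ≃ₐ[ZMod p] F)

lemma two_ne_zero_of_algebra (hp : p ≠ 2) : (2 : F) ≠ 0 := by
  have : CharP F p := charP_of_injective_algebraMap (algebraMap (ZMod p) F).injective p
  intro h
  have h2 : ((2 : ℕ) : F) = 0 := by exact_mod_cast h
  rw [CharP.cast_eq_zero_iff F p] at h2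
  exact hp ((Nat.prime_dvd_prime_iff_eq Fact.out Nat.prime_two).mp h2)

/-- The quotient of a solution of `σ y = κ y` by a nonzero one is fixed by `σ`, hence lies in the
prime field. -/
lemma finrank_le_one_of_semilinear_eigen
    (hσ : ∀ x, σ x = x → ∃ k : ZMod p, algebraMap (ZMod p) F k = x)
    {W : Type*} [AddCommGroup W] [Module (ZMod p) W]
    (f : W →ₗ[ZMod p] F) (hf : Function.Injective f) (κ : F) (h : ∀ w, σ (f w) = κ * f w) :
    Module.finrank (ZMod p) W ≤ 1 := by
  by_cases h0 : ∃ v : W, f v ≠ 0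
  · obtain ⟨v, hv⟩ := h0
    refine finrank_le_one v fun w => ?_
    have hκ : κ ≠ 0 := by
      rintro rfl
      have := h v
      rw [zero_mul] at this
      exact hv (by simpa using this)
    obtain ⟨k, hk⟩ := hσ (f w / f v) (by rw [map_div₀, h, h, mul_div_mul_left _ _ hκ])
    refine ⟨k, hf ?_⟩
    rw [map_smul, Algebra.smul_def, hk, div_mul_cancel₀ _ hv]
  · push Not at h0
    refine finrank_le_one 0 fun w => ⟨0, hf ?_⟩
    rw [h0, h0]

/-- The radical of `frobForm σ a b` has dimension at most two. -/
theorem finrank_ker_polarMap_le (hp : p ≠ 2)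
    (hσ : ∀ x, σ x = x → ∃ k : ZMod p, algebraMap (ZMod p) F k = x) {a b : F}
    (hab : ¬ (a = 0 ∧ b = 0)) : Module.finrank (ZMod p) (LinearMap.ker (polarMap σ a b)) ≤ 2 := by
  set V := LinearMap.ker (polarMap σ a b)
  have h2 : (2 : F) ≠ 0 := two_ne_zero_of_algebra hp
  by_cases hV : V = ⊥
  · rw [hV]; simp
  obtain ⟨u, huV, hu⟩ := Submodule.exists_mem_ne_zero_of_ne_bot hV
  -- Applying `σ` removes `σ.symm` and leaves a second-order `σ`-linear equation.
  have heq : ∀ z ∈ V, a * z + σ a * σ (σ z) + 2 * σ b * σ z = 0 := by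
    intro z hz
    have := congrArg σ (LinearMap.mem_ker.mp hz)
    rw [polarMap_apply] at this
    simpa only [map_add, map_mul, map_zero, AlgEquiv.apply_symm_apply, map_ofNat] using this
  have ha : a ≠ 0 := by
    rintro rfl
    have := heq u huV
    simp only [zero_mul, map_zero, zero_add, mul_eq_zero, h2, EmbeddingLike.map_eq_zero_iff, hu,
      false_or, or_false] at this
    exact hab ⟨rfl, this⟩
  have hσ0 : ∀ x : F, x ≠ 0 → σ x ≠ 0 := fun x hx => by simpa using hx
  -- Reduction of order: for `z = u w` the difference `σ w - w` satisfies a first-order equation,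
  -- and it vanishes exactly when `σ z = (σ u / u) z`. So the range and the kernel of `φ` both have
  -- dimension at most one.
  let φ : V →ₗ[ZMod p] F :=
    (σ.toLinearMap - LinearMap.id) ∘ₗ LinearMap.mulRight (ZMod p) u⁻¹ ∘ₗ V.subtype
  have hφ : ∀ z : V, φ z = σ (z * u⁻¹) - z * u⁻¹ := fun z => rfl
  have h1 : Module.finrank (ZMod p) (LinearMap.range φ) ≤ 1 := by
    refine finrank_le_one_of_semilinear_eigen σ hσ (LinearMap.range φ).subtype
      (Submodule.subtype_injective _) (-(1 + 2 * σ b * σ u / (σ a * σ (σ u)))) ?_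
    rintro ⟨_, z, rfl⟩
    change σ (φ z) = _ * φ z
    rw [hφ]
    obtain ⟨w, hw⟩ : ∃ w, w = (z : F) * u⁻¹ := ⟨_, rfl⟩
    have hz : (z : F) = u * w := by rw [hw]; field_simp
    have e1 := heq u huV
    have e2 := heq z z.2
    rw [hz] at e2
    simp only [map_mul] at e2
    rw [← hw, map_sub]
    have := hσ0 a ha
    have := hσ0 _ (hσ0 u hu)
    field_simp
    linear_combination e2 - w * e1
  have h2 : Module.finrank (ZMod p) (LinearMap.ker φ) ≤ 1 := by
    refine finrank_le_one_of_semilinear_eigen σ hσ (V.subtype ∘ₗ (LinearMap.ker φ).subtype)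
      ((Submodule.subtype_injective _).comp (Submodule.subtype_injective _)) (σ u / u) ?_
    rintro ⟨z, hz⟩
    have := LinearMap.mem_ker.mp hz
    rw [hφ, map_mul, map_inv₀] at this
    change σ (z : F) = σ u / u * z
    have := hσ0 u hu
    field_simp at *
    linear_combination this
  have := φ.finrank_range_add_finrank_ker
  omega

end Kernel

/-! ### Power moments of the exponential sums -/

section Moments

variable {p : ℕ} [Fact p.Prime] {F : Type*} [Field F] [Fintype F] [Algebra (ZMod p) F]

/-- Orthogonality in `a` and in `b` separately; it turns every moment below into a count of common
zeros. -/
lemma sum_sum_sum_traceChar {ι : Type*} [Fintype ι] [DecidableEq F] (A B : ι → F) :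
    ∑ a : F, ∑ b : F, ∑ i, traceChar p F (a * A i + b * B i) =
      (Fintype.card F : ℂ) ^ 2 * #{i | A i = 0 ∧ B i = 0} := by
  calc _ = ∑ i, (∑ a : F, traceChar p F (a * A i)) * ∑ b : F, traceChar p F (b * B i) := by
        simp_rw [sum_mul_sum, ← AddChar.map_add_eq_mul]
        symm
        rw [sum_comm]
        exact sum_congr rfl fun a _ => sum_comm
    _ = ∑ i, if A i = 0 ∧ B i = 0 then (Fintype.card F : ℂ) ^ 2 else 0 := by
        refine sum_congr rfl fun i _ => ?_
        rw [sum_traceChar_mul, sum_traceChar_mul]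
        by_cases h1 : A i = 0 <;> by_cases h2 : B i = 0 <;> simp [h1, h2, sq]
    _ = _ := by rw [← sum_filter, sum_const, nsmul_eq_mul, mul_comm]

variable (σ : F ≃ₐ[ZMod p] F)

lemma expSum_smul_zero (a b : F) (y : ZMod p) : expSum σ (y • a) (y • b) 0 =
    ∑ x : F, traceChar p F (a * (y • (x * σ x)) + b * (y • x ^ 2)) := by
  refine sum_congr rfl fun x _ => ?_
  rw [zero_mul, add_zero, smul_mul_assoc, smul_mul_assoc, mul_smul_comm, mul_smul_comm]

lemma expSum_mul_expSum_smul (a b : F) (y : ZMod p) :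
    expSum σ a b 0 * expSum σ (y • a) (y • b) 0 =
      ∑ x : F × F, traceChar p F (a * (x.1 * σ x.1 + y • (x.2 * σ x.2)) +
        b * (x.1 ^ 2 + y • x.2 ^ 2)) := by
  rw [expSum_smul_zero, expSum, sum_mul_sum, Fintype.sum_prod_type]
  refine sum_congr rfl fun x _ => sum_congr rfl fun z _ => ?_
  rw [← AddChar.map_add_eq_mul]
  congr 1; ring

lemma sum_expSum_smul {y : ZMod p} (hy : y ≠ 0) :
    ∑ a, ∑ b, expSum σ (y • a) (y • b) 0 = (Fintype.card F : ℂ) ^ 2 := by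
  classical
  simp_rw [expSum_smul_zero, sum_sum_sum_traceChar]
  have : (univ.filter fun x : F => y • (x * σ x) = 0 ∧ y • x ^ 2 = 0) = {0} := by
    ext x; simp [hy]
  rw [this]; simp

/-- The system has only the zero solution: for a nonzero one, comparing the two equations shows that
`x / z` is fixed by `σ`, so it lies in the prime field, and its square is `-y`. -/
lemma sum_expSum_mul_expSum_smul (hσ : ∀ x, σ x = x → ∃ k : ZMod p, algebraMap (ZMod p) F k = x)
    {y : ZMod p} (hy : ¬ IsSquare (-y)) :
    ∑ a, ∑ b, expSum σ a b 0 * expSum σ (y • a) (y • b) 0 = (Fintype.card F : ℂ) ^ 2 := by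
  classical
  simp_rw [expSum_mul_expSum_smul, sum_sum_sum_traceChar]
  have : (univ.filter fun x : F × F => x.1 * σ x.1 + y • (x.2 * σ x.2) = 0 ∧
      x.1 ^ 2 + y • x.2 ^ 2 = 0) = {0} := by
    ext ⟨x, z⟩
    simp only [mem_filter, mem_univ, true_and, mem_singleton, Prod.mk_eq_zero]
    constructor
    · rintro ⟨h1, h2⟩
      by_cases hz : z = 0
      · subst hz; simpa using h2
      exfalso
      by_cases hx : x = 0
      · subst hx
        have : y = 0 := by simpa [hz] using h2
        rw [this] at hy; simp at hy
      obtain ⟨k, hk⟩ := hσ (x / z) (by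
        have hσz : σ z ≠ 0 := by simpa using hz
        rw [map_div₀, div_eq_div_iff hσz hz]
        rw [Algebra.smul_def] at h1 h2
        refine mul_left_cancel₀ (mul_ne_zero hx hz) ?_
        linear_combination z ^ 2 * h1 - z * σ z * h2)
      refine hy ⟨k, (algebraMap (ZMod p) F).injective ?_⟩
      rw [map_mul, hk, map_neg]
      rw [Algebra.smul_def] at h2
      field_simp
      linear_combination -h2
    · rintro ⟨rfl, rfl⟩; simp
  rw [this]; simp

/-- The equation `x ^ 2 = z ^ 2` leaves `z = x` or `z = -x`, where the other equation is automatic.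
The zero solution is counted with the first family only. -/
lemma sum_expSum_mul_expSum_neg (hp : p ≠ 2) :
    ∑ a, ∑ b, expSum σ a b 0 * expSum σ (-a) (-b) 0 =
      (Fintype.card F : ℂ) ^ 2 * (2 * Fintype.card F - 1) := by
  classical
  have h0 := expSum_mul_expSum_smul σ (y := -1)
  simp only [neg_smul, one_smul] at h0
  simp_rw [h0, sum_sum_sum_traceChar]
  have hS : (univ.filter fun x : F × F => x.1 * σ x.1 + -(x.2 * σ x.2) = 0 ∧
      x.1 ^ 2 + -x.2 ^ 2 = 0) =
      univ.image (fun x : F => (x, x)) ∪ (univ.erase 0).image (fun x : F => (x, -x)) := by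
    ext ⟨x, z⟩
    simp only [mem_filter, mem_univ, true_and, mem_union, mem_image, mem_erase, Prod.mk.injEq,
      and_true]
    constructor
    · rintro ⟨-, h⟩
      have : (x - z) * (x + z) = 0 := by linear_combination h
      rcases mul_eq_zero.mp this with h | h
      · exact Or.inl ⟨x, rfl, by linear_combination h⟩
      · by_cases hx : x = 0
        · exact Or.inl ⟨x, rfl, by linear_combination -h + 2 * hx⟩
        · exact Or.inr ⟨x, hx, rfl, by linear_combination -h⟩
    · rintro (⟨x, rfl, rfl⟩ | ⟨x, -, rfl, rfl⟩) <;> simp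
  have hd : Disjoint (univ.image (fun x : F => (x, x)))
      ((univ.erase 0).image (fun x : F => (x, -x))) := by
    rw [disjoint_left]
    intro x hx hx'
    obtain ⟨u, -, rfl⟩ := mem_image.mp hx
    obtain ⟨v, hv, h⟩ := mem_image.mp hx'
    simp only [mem_erase, mem_univ, and_true, Prod.mk.injEq] at hv h
    refine hv ((mul_eq_zero.mp (?_ : 2 * v = 0)).resolve_left (two_ne_zero_of_algebra hp))
    linear_combination h.1 - h.2
  rw [hS, card_union_of_disjoint hd, card_image_of_injective _ (fun x y h => (Prod.ext_iff.mp h).1),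
    card_image_of_injective _ (fun x y h => (Prod.ext_iff.mp h).1), card_erase_of_mem (mem_univ _),
    card_univ, Nat.cast_add, Nat.cast_sub Fintype.card_pos]
  push_cast; ring

/-- In the coordinates `u, v` below, `u = 0` forces `z = 0` and leaves `v` free, which gives `q`
solutions. For each `u ≠ 0` the solutions are parametrised by one element of the prime field, which
gives `(q - 1) p` more. -/
lemma sum_expSum_mul_expSum_neg_mul_expSum (hp : p ≠ 2)
    (hσ : ∀ x, σ x = x → ∃ k : ZMod p, algebraMap (ZMod p) F k = x) :
    ∑ a, ∑ b, expSum σ a b 0 * expSum σ (-a) (-b) 0 * expSum σ a b 0 =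
      (Fintype.card F : ℂ) ^ 2 * (Fintype.card F + (Fintype.card F - 1) * p) := by
  classical
  have h0 := expSum_mul_expSum_smul σ (y := -1)
  simp only [neg_smul, one_smul] at h0
  have h20 : (2 : F) ≠ 0 := two_ne_zero_of_algebra hp
  have h1 : ∀ a b : F, expSum σ a b 0 * expSum σ (-a) (-b) 0 * expSum σ a b 0 =
      ∑ x : (F × F) × F, traceChar p F (a * (2 * (x.1.1 * σ x.1.2 + x.1.2 * σ x.1.1) +
        x.2 * σ x.2) + b * (4 * x.1.1 * x.1.2 + x.2 ^ 2)) := by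
    intro a b
    -- The substitution `(u + v, u - v)` turns the difference of two values of each form into a
    -- bilinear expression in `u` and `v`.
    let e : F × F ≃ F × F :=
      { toFun := fun x => (x.1 + x.2, x.1 - x.2)
        invFun := fun x => ((x.1 + x.2) / 2, (x.1 - x.2) / 2)
        left_inv := fun x => by ext <;> simp <;> field_simp <;> ring
        right_inv := fun x => by ext <;> simp <;> field_simp <;> ring }
    rw [h0, ← e.sum_comp, expSum, sum_mul_sum, Fintype.sum_prod_type (α₁ := F × F)]
    refine sum_congr rfl fun x _ => sum_congr rfl fun z _ => ?_
    rw [← AddChar.map_add_eq_mul]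
    congr 1
    simp only [e, Equiv.coe_fn_mk, map_add, map_sub]
    ring
  simp_rw [h1, sum_sum_sum_traceChar]
  have hS : (univ.filter fun x : (F × F) × F => 2 * (x.1.1 * σ x.1.2 + x.1.2 * σ x.1.1) +
        x.2 * σ x.2 = 0 ∧ 4 * x.1.1 * x.1.2 + x.2 ^ 2 = 0) =
      univ.image (fun v : F => ((0, v), 0)) ∪ (univ.erase 0 ×ˢ univ).image
        (fun x : F × ZMod p => ((x.1, -(x.2 ^ 2) • x.1), (2 * x.2) • x.1)) := by
    ext ⟨⟨u, v⟩, z⟩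
    simp only [mem_filter, mem_univ, true_and, mem_union, mem_image, mem_erase, Prod.mk.injEq,
      and_true, mem_product, Prod.exists]
    constructor
    · rintro ⟨h2, h3⟩
      by_cases hu : u = 0
      · subst hu
        exact Or.inl ⟨v, ⟨rfl, rfl⟩, ((pow_eq_zero_iff two_ne_zero).mp (by simpa using h3)).symm⟩
      · right
        have hσu : σ u ≠ 0 := by simpa using hu
        -- With this `w` the second equation becomes `v = -w ^ 2 u`, and the first then says `(σ w -
        -- w) ^ 2 = 0`.
        obtain ⟨w, hw⟩ : ∃ w, w = z / (2 * u) := ⟨_, rfl⟩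
        have hz : z = 2 * u * w := by rw [hw]; field_simp
        have hv : v = - (w ^ 2 * u) := by
          rw [hz] at h3
          refine mul_left_cancel₀ (mul_ne_zero (mul_ne_zero h20 h20) hu) ?_
          linear_combination h3
        obtain ⟨k, hk⟩ := hσ w (by
          rw [hz, hv] at h2
          simp only [map_neg, map_mul, map_pow, map_ofNat] at h2
          have : (2 * u * σ u) * (σ w - w) ^ 2 = 0 := by linear_combination -h2
          have := (mul_eq_zero.mp this).resolve_left (mul_ne_zero (mul_ne_zero h20 hu) hσu)
          exact sub_eq_zero.mp (pow_eq_zero_iff two_ne_zero |>.mp this))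
        refine ⟨u, k, hu, ⟨rfl, ?_⟩, ?_⟩
        · rw [hv, Algebra.smul_def, map_neg, map_pow, hk]; ring
        · rw [hz, Algebra.smul_def, map_mul, hk, map_ofNat]; ring
    · rintro (⟨v, ⟨rfl, rfl⟩, rfl⟩ | ⟨u, k, -, ⟨rfl, rfl⟩, rfl⟩)
      · simp
      · simp only [Algebra.smul_def, map_mul, map_neg, map_pow, map_ofNat, AlgEquiv.commutes]
        constructor <;> ring
  have hd : Disjoint (univ.image (fun v : F => (((0 : F), v), (0 : F)))) ((univ.erase 0 ×ˢ univ).image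
        (fun x : F × ZMod p => ((x.1, -(x.2 ^ 2) • x.1), (2 * x.2) • x.1))) := by
    rw [disjoint_left]
    intro x hx hx'
    obtain ⟨u, -, rfl⟩ := mem_image.mp hx
    obtain ⟨v, hv, h⟩ := mem_image.mp hx'
    simp only [mem_product, mem_erase, mem_univ, and_true, Prod.mk.injEq] at hv h
    exact hv h.1.1
  have hinj : Set.InjOn (fun x : F × ZMod p => ((x.1, -(x.2 ^ 2) • x.1), (2 * x.2) • x.1))
      (univ.erase (0 : F) ×ˢ (univ : Finset (ZMod p)) : Finset (F × ZMod p)) := by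
    rintro ⟨u, k⟩ hu ⟨v, k'⟩ - h
    simp only [coe_product, Set.mem_prod, mem_coe, mem_erase, mem_univ, and_true] at hu
    simp only [Prod.mk.injEq] at h
    obtain ⟨⟨rfl, -⟩, h⟩ := h
    rw [Algebra.smul_def, Algebra.smul_def] at h
    have h := mul_right_cancel₀ hu h
    simp only [map_mul, map_ofNat] at h
    rw [(algebraMap (ZMod p) F).injective (mul_left_cancel₀ h20 h)]
  rw [hS, card_union_of_disjoint hd,
    card_image_of_injective _ (fun x y h => by simpa using h), card_image_of_injOn hinj,
    card_product, card_erase_of_mem (mem_univ _),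
    card_univ, card_univ, ZMod.card, Nat.cast_add, Nat.cast_mul, Nat.cast_sub Fintype.card_pos]
  push_cast; ring

end Moments

/-! ### The six kinds of forms and their frequencies -/

section Kinds

variable {p : ℕ} [Fact p.Prime] {F : Type*} [Field F] [Fintype F] [Algebra (ZMod p) F]
  (σ : F ≃ₐ[ZMod p] F)

variable (p) in
/-- The normalised size of the exponential sum of a quadratic form with given corank. -/
def kindConst : Fin 3 → ℂ := ![1, quadGauss p, p]

/-- The form `frobForm σ a b` in `2 * n` variables has corank `κ.1` and type `κ.2`. -/
structure IsKind (n : ℕ) (x : F × F) (κ : Fin 3 × ℤˣ) : Prop where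
  card_ker : Nat.card (LinearMap.ker (polarMap σ x.1 x.2)) = p ^ (κ.1 : ℕ)
  expSum_smul : ∀ y : ZMod p, y ≠ 0 → expSum σ (y • x.1) (y • x.2) 0 =
    quadCharC p y ^ (κ.1 : ℕ) * ((κ.2 : ℤ) : ℂ) * p ^ n * kindConst p κ.1

/-- The dimension is even, so `χ(y) ^ (2n - k) = χ(y) ^ k`, and `G ^ 2 = χ(-1) p` reduces the power
of `G` to a power of `p`, leaving one factor `G` when `k = 1`. The sign from `χ(-1)` is absorbed
into the type. -/
lemma exists_isKind (hp : p ≠ 2) {n : ℕ} (hn : 1 ≤ n) (hF : Fintype.card F = p ^ (2 * n))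
    (hσ : ∀ x, σ x = x → ∃ k : ZMod p, algebraMap (ZMod p) F k = x) {x : F × F} (hx : x ≠ 0) :
    ∃ κ, IsKind σ n x κ := by
  obtain ⟨a, b⟩ := x
  obtain ⟨k, hk, ε, h⟩ := exists_expSum_smul σ hp hF a b
  have hp1 : 1 < p := (Fact.out : p.Prime).one_lt
  have hε : ((ε : ℤ) : ℂ) ^ 2 = 1 := by
    rcases Int.units_eq_one_or ε with rfl | rfl <;> simp
  have hG := quadGauss_sq hp
  have hχ := quadCharC_sq (p := p) (x := -1) (by simp)
  -- The product of the sums at `y = 1` and `y = -1` is `card F * card ker`, which identifies `k`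
  -- with the corank.
  have hker : Nat.card (LinearMap.ker (polarMap σ a b)) = p ^ k := by
    have h1 := expSum_mul_expSum_neg σ hp a b
    have h2 := h 1 one_ne_zero
    have h3 := h (-1) (by simp)
    simp only [one_smul, neg_smul, map_one, one_pow, one_mul] at h2 h3
    rw [h2, h3, hF] at h1
    have h4 : (Nat.card (LinearMap.ker (polarMap σ a b)) : ℂ) * p ^ (2 * n) =
        p ^ k * p ^ (2 * n) := by
      have h5 : (p : ℂ) ^ (2 * n) = p ^ k * p ^ (2 * n - k) := by
        rw [← pow_add, Nat.add_sub_cancel' hk]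
      push_cast at h1
      calc _ = (quadCharC p (-1) * quadGauss p ^ 2) ^ (2 * n - k) * ((ε : ℤ) : ℂ) ^ 2 *
            p ^ k * p ^ k := by rw [mul_comm, ← h1, mul_pow]; ring
        _ = (quadCharC p (-1) ^ 2 * p) ^ (2 * n - k) * p ^ k * p ^ k := by
            rw [hG, hε]; ring
        _ = _ := by rw [hχ, h5]; ring
    have h6 := mul_right_cancel₀ (pow_ne_zero _ (by exact_mod_cast (by omega : p ≠ 0))) h4
    exact_mod_cast h6
  have hk2 : k ≤ 2 := by
    have h1 := finrank_ker_polarMap_le σ hp hσ (a := a) (b := b) (by simpa using hx)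
    have h2 := Module.natCard_eq_pow_finrank (K := ZMod p)
      (V := LinearMap.ker (polarMap σ a b))
    rw [hker, Nat.card_zmod] at h2
    rwa [Nat.pow_right_injective hp1 h2]
  obtain ⟨s, hs⟩ : ∃ s : ℤˣ, quadCharC p (-1) = ((s : ℤ) : ℂ) := by
    rcases quadraticChar_dichotomy (F := ZMod p) (a := -1) (by simp) with h | h
    · exact ⟨1, by rw [quadCharC_apply, h]; simp⟩
    · exact ⟨-1, by rw [quadCharC_apply, h]; simp⟩
  rw [hs] at hG
  obtain ⟨n, rfl⟩ : ∃ n', n = n' + 1 := ⟨n - 1, by omega⟩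
  interval_cases k
  · refine ⟨(0, ε * s ^ (n + 1)), by simpa using hker, fun y hy => ?_⟩
    rw [h y hy, Nat.sub_zero, pow_mul, pow_mul, quadCharC_sq hy, hG]
    simp [kindConst, mul_pow]; ring
  · refine ⟨(1, ε * s ^ n), by simpa using hker, fun y hy => ?_⟩
    have e1 : 2 * (n + 1) - 1 = 2 * n + 1 := by omega
    rw [h y hy, e1, pow_succ (quadCharC p y), pow_succ (quadGauss p), pow_mul, pow_mul,
      quadCharC_sq hy, hG]
    simp [kindConst, mul_pow]; ring
  · refine ⟨(2, ε * s ^ n), by simpa using hker, fun y hy => ?_⟩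
    have e1 : 2 * (n + 1) - 2 = 2 * n := by omega
    rw [h y hy, e1, pow_mul, pow_mul, quadCharC_sq hy, hG]
    simp [kindConst, mul_pow, quadCharC_sq hy]; ring

open Classical in
/-- The corank and the type of a form `frobForm σ a b`. -/
def kindOf (n : ℕ) (x : F × F) : Fin 3 × ℤˣ :=
  -- The default is harmless: in the setting of `exists_isKind` every nonzero `x` has a kind, and
  -- the counts leave out `x = 0`.
  if h : ∃ κ, IsKind σ n x κ then h.choose else (0, 1)

open Classical in
/-- The number of nonzero parameters whose form has given corank and type. -/
def kindCount (n : ℕ) (κ : Fin 3 × ℤˣ) : ℕ := #{x : F × F | x ≠ 0 ∧ kindOf σ n x = κ}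

lemma isKind_kindOf (hp : p ≠ 2) {n : ℕ} (hn : 1 ≤ n) (hF : Fintype.card F = p ^ (2 * n))
    (hσ : ∀ x, σ x = x → ∃ k : ZMod p, algebraMap (ZMod p) F k = x) {x : F × F} (hx : x ≠ 0) :
    IsKind σ n x (kindOf σ n x) := by
  have := exists_isKind σ hp hn hF hσ hx
  rw [kindOf, dif_pos this]
  exact this.choose_spec

lemma sum_kindOf {R : Type*} [CommSemiring R] (n : ℕ) (f : Fin 3 × ℤˣ → R) [DecidableEq F] :
    ∑ x ∈ univ.erase (0 : F × F), f (kindOf σ n x) = ∑ κ, kindCount σ n κ * f κ := by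
  classical
  rw [← sum_fiberwise (s := univ.erase (0 : F × F)) (g := kindOf σ n)]
  refine sum_congr rfl fun κ _ => ?_
  rw [sum_congr rfl (g := fun _ => f κ) fun x hx => by rw [(mem_filter.mp hx).2], sum_const,
    nsmul_eq_mul, kindCount]
  congr 3
  ext x; simp

lemma sum_kind {R : Type*} [AddCommMonoid R] (f : Fin 3 × ℤˣ → R) :
    ∑ κ, f κ = f (0, 1) + f (0, -1) + (f (1, 1) + f (1, -1)) + (f (2, 1) + f (2, -1)) := by
  rw [Fintype.sum_prod_type, Fin.sum_univ_three]
  have : (univ : Finset ℤˣ) = {1, -1} := rfl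
  simp [this, sum_pair (show (1 : ℤˣ) ≠ -1 by decide)]

lemma sum_sum_eq_add_sum_kind [DecidableEq F] (n : ℕ) (f : F → F → ℂ) (g : Fin 3 × ℤˣ → ℂ)
    (h : ∀ x : F × F, x ≠ 0 → f x.1 x.2 = g (kindOf σ n x)) :
    ∑ a, ∑ b, f a b = f 0 0 + ∑ κ, kindCount σ n κ * g κ := by
  rw [← Fintype.sum_prod_type', ← add_sum_erase _ _ (mem_univ (0 : F × F)), ← sum_kindOf]
  congr 1
  exact sum_congr rfl fun x hx => h x (mem_erase.mp hx).1

lemma expSum_zero : expSum σ 0 0 0 = Fintype.card F := by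
  simp [expSum]

variable {σ} in
/-- The number of forms `frobForm σ a b` of each corank and type. -/
theorem kindCount_eq (hp : p ≠ 2) {n : ℕ} (hn : 1 ≤ n) (hF : Fintype.card F = p ^ (2 * n))
    (hσ : ∀ x, σ x = x → ∃ k : ZMod p, algebraMap (ZMod p) F k = x) {s q : ℚ}
    (hs : s = p ^ (n - 1)) (hq : q = p ^ 2 * s ^ 2) :
    (∀ ε : ℤˣ, 2 * (p ^ 2 - 1) * (kindCount σ n (0, ε) : ℚ) =
      (q - 1) * (p ^ 2 * q - p * q - q + p ^ 2 + (ε : ℤ) * (p ^ 2 * (p - 1) * s))) ∧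
    (kindCount σ n (1, 1) + kindCount σ n (1, -1) : ℚ) = p * s ^ 2 * (q - 1) ∧
    (∀ ε : ℤˣ, 2 * (p ^ 2 - 1) * (kindCount σ n (2, ε) : ℚ) =
      (q - 1) * (p * s ^ 2 - 1 + (ε : ℤ) * (s * (p - 1)))) := by
  classical
  have hp0 : (p : ℂ) ≠ 0 := by exact_mod_cast (Fact.out : p.Prime).ne_zero
  have hG := quadGauss_sq hp
  have hG0 := quadGauss_ne_zero hp
  have hk := fun x hx => isKind_kindOf σ hp hn hF hσ (x := x) hx
  have hqC : (Fintype.card F : ℂ) = q := by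
    rw [hF, hq, hs, ← mul_pow]; push_cast; rw [← pow_succ', Nat.sub_add_cancel hn]; ring
  have hsC : (p : ℂ) ^ n = p * s := by
    rw [hs]; push_cast; rw [← pow_succ', Nat.sub_add_cancel hn]
  have hqs : (q : ℂ) = (p * s) ^ 2 := by rw [hq]; push_cast; ring
  have hs0 : (s : ℂ) ≠ 0 := by
    rw [hs]; push_cast; exact pow_ne_zero _ hp0
  -- Linear equations for the six frequencies: the total number (`e0`), the first moment twisted by
  -- `y` (`e1`), two second moments (`e2`, `e2'`) and a third moment (`e3`). In each, the parameter
  -- `x = 0` is split off.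
  obtain ⟨c, hc⟩ : ∃ c : Fin 3 × ℤˣ → ℂ, ∀ κ, c κ = kindCount σ n κ := ⟨_, fun _ => rfl⟩
  have e0 : (q : ℂ) ^ 2 = 1 + ∑ κ, c κ := by
    have := sum_sum_eq_add_sum_kind σ n (fun _ _ => 1) (fun _ => 1) (fun _ _ => rfl)
    simp only [sum_const, card_univ, nsmul_eq_mul, mul_one, hqC, ← hc] at this
    rw [← this]; ring
  have e1 : ∀ y : ZMod p, y ≠ 0 → (q : ℂ) ^ 2 = q + ∑ κ : Fin 3 × ℤˣ,
      c κ * (quadCharC p y ^ (κ.1 : ℕ) * ((κ.2 : ℤ) : ℂ) * (p * s) * kindConst p κ.1) := by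
    intro y hy
    have := sum_sum_eq_add_sum_kind σ n (fun a b => expSum σ (y • a) (y • b) 0)
      (fun κ => quadCharC p y ^ (κ.1 : ℕ) * ((κ.2 : ℤ) : ℂ) * p ^ n * kindConst p κ.1)
      (fun x hx => (hk x hx).expSum_smul y hy)
    simpa only [sum_expSum_smul σ hy, smul_zero, expSum_zero, hqC, ← hc, hsC] using this
  have hker : ∀ x : F × F, x ≠ 0 → expSum σ x.1 x.2 0 * expSum σ (-x.1) (-x.2) 0 =
      q * p ^ ((kindOf σ n x).1 : ℕ) := by
    intro x hx
    rw [expSum_mul_expSum_neg σ hp, (hk x hx).card_ker, hqC]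
    push_cast; rfl
  have hone : ∀ x : F × F, x ≠ 0 → expSum σ x.1 x.2 0 = (((kindOf σ n x).2 : ℤ) : ℂ) * (p * s) *
      kindConst p (kindOf σ n x).1 := by
    intro x hx
    have := (hk x hx).expSum_smul 1 one_ne_zero
    simpa [hsC] using this
  have e2 : (q : ℂ) ^ 2 * (2 * q - 1) = q ^ 2 + ∑ κ : Fin 3 × ℤˣ, c κ * (q * p ^ (κ.1 : ℕ)) := by
    have := sum_sum_eq_add_sum_kind σ n (fun a b => expSum σ a b 0 * expSum σ (-a) (-b) 0)
      (fun κ => q * p ^ (κ.1 : ℕ)) hker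
    simp only [sum_expSum_mul_expSum_neg σ hp, neg_zero, expSum_zero, hqC, ← hc] at this
    rw [this]; ring
  -- A nonsquare `t`. It serves as a twist in `e1`, and `-t` serves as the twist in `e2'`, where the
  -- negative of the twist must be a nonsquare.
  obtain ⟨t, ht⟩ := quadraticChar_exists_neg_one (ringChar_zmod_ne_two hp)
  have ht0 : t ≠ 0 := by rintro rfl; simp at ht
  have e2' : (0 : ℂ) = ∑ κ : Fin 3 × ℤˣ,
      c κ * (quadCharC p (-t) ^ (κ.1 : ℕ) * (kindConst p κ.1) ^ 2) := by
    have h1 : ∀ x : F × F, x ≠ 0 → expSum σ x.1 x.2 0 * expSum σ ((-t) • x.1) ((-t) • x.2) 0 =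
        q * (quadCharC p (-t) ^ ((kindOf σ n x).1 : ℕ) * (kindConst p (kindOf σ n x).1) ^ 2) := by
      intro x hx
      rw [(hk x hx).expSum_smul _ (neg_ne_zero.mpr ht0), hone x hx, hsC, hqs]
      have : (((kindOf σ n x).2 : ℤ) : ℂ) ^ 2 = 1 := by
        rcases Int.units_eq_one_or (kindOf σ n x).2 with h | h <;> simp [h]
      linear_combination quadCharC p (-t) ^ ((kindOf σ n x).1 : ℕ) *
        (kindConst p (kindOf σ n x).1) ^ 2 * (p * s) ^ 2 * this
    have := sum_sum_eq_add_sum_kind σ n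
      (fun a b => expSum σ a b 0 * expSum σ ((-t) • a) ((-t) • b) 0)
      (fun κ => q * (quadCharC p (-t) ^ (κ.1 : ℕ) * (kindConst p κ.1) ^ 2)) h1
    rw [sum_expSum_mul_expSum_smul σ hσ] at this
    · simp only [smul_zero, expSum_zero, hqC, ← hc] at this
      have hq0 : (q : ℂ) ≠ 0 := by rw [hqs]; exact pow_ne_zero _ (mul_ne_zero hp0 hs0)
      refine mul_left_cancel₀ hq0 ?_
      rw [mul_sum]
      rw [sum_congr rfl fun κ _ => mul_left_comm (q : ℂ) (c κ) _]
      linear_combination this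
    · rw [neg_neg]
      exact quadraticChar_neg_one_iff_not_isSquare.mp ht
  have e3 : (q : ℂ) ^ 2 * (q + (q - 1) * p) = q ^ 3 + ∑ κ : Fin 3 × ℤˣ,
      c κ * (q * p ^ (κ.1 : ℕ) * (((κ.2 : ℤ) : ℂ) * (p * s) * kindConst p κ.1)) := by
    have := sum_sum_eq_add_sum_kind σ n
      (fun a b => expSum σ a b 0 * expSum σ (-a) (-b) 0 * expSum σ a b 0)
      (fun κ => q * p ^ (κ.1 : ℕ) * (((κ.2 : ℤ) : ℂ) * (p * s) * kindConst p κ.1))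
      (fun x hx => by rw [hker x hx, hone x hx])
    simp only [sum_expSum_mul_expSum_neg_mul_expSum σ hp hσ, neg_zero, expSum_zero, hqC, ← hc]
      at this
    rw [this]; ring
  have htC : quadCharC p t = -1 := by rw [quadCharC_apply, ht]; simp
  have hnt : quadCharC p (-t) * quadGauss p ^ 2 = -p := by
    have h1 := quadCharC_sq (p := p) (x := -1) (by simp)
    have h2 : quadCharC p (-t) = quadCharC p (-1) * quadCharC p t := by rw [← map_mul]; simp
    rw [h2, htC, hG]
    linear_combination - (p : ℂ) * h1
  have hnt2 : quadCharC p (-t) ^ 2 = 1 := quadCharC_sq (neg_ne_zero.mpr ht0)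
  have e1p := e1 1 one_ne_zero
  have e1m := e1 t ht0
  rw [sum_kind] at e0 e1p e1m e2 e2' e3
  simp only [htC, kindConst] at e1p e1m e2 e2' e3
  simp at e0 e1p e1m e2 e2' e3
  rw [hnt, hnt2] at e2'
  have hq0 : (q : ℂ) ≠ 0 := by rw [hqs]; exact pow_ne_zero _ (mul_ne_zero hp0 hs0)
  have hps : (p : ℂ) * s ≠ 0 := mul_ne_zero hp0 hs0
  -- The first moments at 1 and at `t` differ only in the sign of the corank-one part, so their
  -- difference shows that both corank-one types are equally frequent, and their mean is `hA`. Then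
  -- `hA` and `hB` give the differences between the types for coranks 0 and 2, while `e0`, `e2'` and
  -- `hC` give the sums.
  have hD1 : c (1, 1) - c (1, -1) = 0 := by
    refine (mul_eq_zero.mp (?_ : (2 * (p * s) * quadGauss p) * (c (1, 1) - c (1, -1)) = 0)
      ).resolve_left (mul_ne_zero (mul_ne_zero two_ne_zero hps) hG0)
    linear_combination e1m - e1p
  have hA : (p : ℂ) * s * (q - 1) = c (0, 1) - c (0, -1) + p * (c (2, 1) - c (2, -1)) := by
    refine mul_left_cancel₀ hps ?_
    linear_combination e1p / 2 + e1m / 2 - (q - 1) * hqs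
  have hB : (p : ℂ) * (p * s) * (q - 1) =
      c (0, 1) - c (0, -1) + p ^ 3 * (c (2, 1) - c (2, -1)) := by
    refine mul_left_cancel₀ (mul_ne_zero hq0 hps) ?_
    linear_combination e3 - q * (q - 1) * p * hqs + q * (p * s * quadGauss p) * p * hD1
  have hC : 2 * (q : ℂ) * (q - 1) = c (0, 1) + c (0, -1) + p * (c (1, 1) + c (1, -1)) +
      p ^ 2 * (c (2, 1) + c (2, -1)) := by
    refine mul_left_cancel₀ hq0 ?_
    linear_combination e2
  have hN1 : c (1, 1) + c (1, -1) = p * s ^ 2 * (q - 1) := by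
    refine mul_left_cancel₀ (mul_ne_zero two_ne_zero hp0) ?_
    linear_combination -hC + e2' + 2 * (q - 1) * hqs
  have hD2 : ((p : ℂ) ^ 2 - 1) * (c (2, 1) - c (2, -1)) = (p - 1) * (q - 1) * s := by
    refine mul_left_cancel₀ hp0 ?_
    linear_combination hA - hB
  have hD0 : ((p : ℂ) ^ 2 - 1) * (c (0, 1) - c (0, -1)) = (q - 1) * (p ^ 2 * (p - 1) * s) := by
    linear_combination (1 - (p : ℂ) ^ 2) * hA - p * hD2
  have hN2 : ((p : ℂ) ^ 2 - 1) * (c (2, 1) + c (2, -1)) = (q - 1) * (p * s ^ 2 - 1) := by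
    linear_combination -e2' + e0 + (p + 1) * hN1 - (q - 1) * hqs
  have hN0 : ((p : ℂ) ^ 2 - 1) * (c (0, 1) + c (0, -1)) =
      (q - 1) * (p ^ 2 * q - p * q - q + p ^ 2) := by
    linear_combination (1 - (p : ℂ) ^ 2) * e0 - (p ^ 2 - 1) * hN1 - hN2 + (q - 1) * p * hqs
  simp only [hc] at hN0 hN1 hN2 hD0 hD2
  refine ⟨fun ε => ?_, by exact_mod_cast hN1, fun ε => ?_⟩
  · have : (2 * (p ^ 2 - 1) * (kindCount σ n (0, ε) : ℂ) =
        (q - 1) * (p ^ 2 * q - p * q - q + p ^ 2 + (ε : ℤ) * (p ^ 2 * (p - 1) * s))) := by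
      rcases Int.units_eq_one_or ε with rfl | rfl
      · push_cast; linear_combination hN0 + hD0
      · push_cast; linear_combination hN0 - hD0
    exact_mod_cast this
  · have : (2 * (p ^ 2 - 1) * (kindCount σ n (2, ε) : ℂ) =
        (q - 1) * (p * s ^ 2 - 1 + (ε : ℤ) * (s * (p - 1)))) := by
      rcases Int.units_eq_one_or ε with rfl | rfl
      · push_cast; linear_combination hN2 + hD2
      · push_cast; linear_combination hN2 - hD2
    exact_mod_cast this

end Kinds

/-! ### Numbers of zeros of the words -/

section ZeroCounts

variable {p : ℕ} [Fact p.Prime] {F : Type*} [Field F] [Fintype F] [Algebra (ZMod p) F]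
  (σ : F ≃ₐ[ZMod p] F)

/-- The number of zeros of `z ↦ tr (a * (z * σ z) + b * z ^ 2 + c * z) + h`, where `x = (a, b)`. -/
def zeroCount (x : F × F) (c : F) (h : ZMod p) : ℕ :=
  #{z : F | Algebra.trace (ZMod p) F (x.1 * (z * σ z) + x.2 * z ^ 2 + c * z) + h = 0}

/-- Orthogonality in `y` detects the zeros; the term `y = 0` contributes `card F`. -/
lemma mul_zeroCount (x : F × F) (c : F) (h : ZMod p) : (p : ℂ) * zeroCount σ x c h =
    Fintype.card F + ∑ y ∈ univ.erase (0 : ZMod p),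
      ZMod.stdAddChar (y * h) * expSum σ (y • x.1) (y • x.2) (y • c) := by
  have h0 : (Fintype.card F : ℂ) = ZMod.stdAddChar ((0 : ZMod p) * h) *
      expSum σ ((0 : ZMod p) • x.1) ((0 : ZMod p) • x.2) ((0 : ZMod p) • c) := by
    simp [expSum]
  rw [h0, add_sum_erase univ (fun y : ZMod p => ZMod.stdAddChar (y * h) *
    expSum σ (y • x.1) (y • x.2) (y • c)) (mem_univ _)]
  simp_rw [expSum, mul_sum]
  rw [sum_comm]
  have : ∀ z : F, ∑ y : ZMod p, ZMod.stdAddChar (y * h) *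
      traceChar p F (y • x.1 * (z * σ z) + y • x.2 * z ^ 2 + y • c * z) =
      if Algebra.trace (ZMod p) F (x.1 * (z * σ z) + x.2 * z ^ 2 + c * z) + h = 0
        then (p : ℂ) else 0 := by
    intro z
    rw [← sum_stdAddChar_mul]
    refine sum_congr rfl fun y _ => ?_
    rw [traceChar_apply, ← AddChar.map_add_eq_mul, smul_mul_assoc, smul_mul_assoc, smul_mul_assoc,
      ← smul_add, ← smul_add, map_smul, smul_eq_mul]
    congr 1; ring
  simp_rw [this]
  rw [← sum_filter, sum_const, nsmul_eq_mul, zeroCount, mul_comm]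

/-- The normalised deviation of the number of zeros of a quadratic polynomial of given kind. -/
def excess (κ : Fin 3 × ℤˣ) (t : ZMod p) : ℤ :=
  κ.2 * ![if t = 0 then (p : ℤ) - 1 else -1, p * quadraticChar (ZMod p) (-t),
    p * if t = 0 then (p : ℤ) - 1 else -1] κ.1

/-- For even corank the quadratic character disappears and a complete character sum minus its term
at 0 remains. For corank one a Gauss sum appears, and together with the factor `G` of `kindConst` it
gives `χ(-1) p`, whence the argument `-t` in `excess`. -/
lemma sum_stdAddChar_mul_kind (hp : p ≠ 2) (κ : Fin 3 × ℤˣ) (n : ℕ) (t : ZMod p) :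
    ∑ y ∈ univ.erase (0 : ZMod p), ZMod.stdAddChar (y * t) *
      (quadCharC p y ^ (κ.1 : ℕ) * ((κ.2 : ℤ) : ℂ) * p ^ n * kindConst p κ.1) =
    p ^ n * (excess κ t : ℂ) := by
  have h0 : ∑ y ∈ univ.erase (0 : ZMod p), (ZMod.stdAddChar (y * t) : ℂ) =
      ((if t = 0 then (p : ℤ) - 1 else -1 : ℤ) : ℂ) := by
    have := sum_stdAddChar_mul t
    rw [← add_sum_erase univ _ (mem_univ (0 : ZMod p)), zero_mul, AddChar.map_zero_eq_one] at this
    split_ifs with ht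
    · rw [if_pos ht] at this; push_cast; linear_combination this
    · rw [if_neg ht] at this; push_cast; linear_combination this
  have h1 : ∑ y ∈ univ.erase (0 : ZMod p), (ZMod.stdAddChar (y * t) * quadCharC p y : ℂ) =
      quadCharC p t * quadGauss p := by
    have := sum_quadCharC_mul_stdAddChar hp t
    rw [← add_sum_erase univ _ (mem_univ (0 : ZMod p)), MulChar.map_zero, zero_mul, zero_add]
      at this
    rw [← this]
    exact sum_congr rfl fun y _ => mul_comm _ _
  have h2 : ∀ y ∈ univ.erase (0 : ZMod p), quadCharC p y ^ 2 = 1 := fun y hy =>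
    quadCharC_sq (mem_erase.mp hy).1
  obtain ⟨k, ε⟩ := κ
  fin_cases k
  · simp only [Fin.mk_zero', pow_zero, one_mul, ← sum_mul, h0, excess,
      kindConst, Matrix.cons_val_zero]
    push_cast; ring
  · have : ∀ y : ZMod p, ZMod.stdAddChar (y * t) *
        (quadCharC p y ^ 1 * ((ε : ℤ) : ℂ) * p ^ n * quadGauss p) =
        ZMod.stdAddChar (y * t) * quadCharC p y * (((ε : ℤ) : ℂ) * p ^ n * quadGauss p) :=
      fun y => by ring
    have hG := quadGauss_sq hp
    have hm : (quadraticChar (ZMod p) (-t) : ℂ) = quadCharC p (-1) * quadCharC p t := by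
      rw [← quadCharC_apply, ← map_mul]; simp
    simp only [kindConst, excess]
    change ∑ y ∈ univ.erase (0 : ZMod p), ZMod.stdAddChar (y * t) *
        (quadCharC p y ^ 1 * ((ε : ℤ) : ℂ) * p ^ n * quadGauss p) =
        p ^ n * (((ε : ℤ) * (p * quadraticChar (ZMod p) (-t)) : ℤ) : ℂ)
    push_cast
    simp_rw [this, ← sum_mul, h1, hm]
    linear_combination ((ε : ℤ) : ℂ) * p ^ n * quadCharC p t * hG
  · have : ∀ y ∈ univ.erase (0 : ZMod p), ZMod.stdAddChar (y * t) *
        (quadCharC p y ^ 2 * ((ε : ℤ) : ℂ) * p ^ n * p) =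
        ZMod.stdAddChar (y * t) * (((ε : ℤ) : ℂ) * p ^ n * p) :=
      fun y hy => by rw [h2 y hy]; ring
    simp only [kindConst, excess]
    change ∑ y ∈ univ.erase (0 : ZMod p), ZMod.stdAddChar (y * t) *
        (quadCharC p y ^ 2 * ((ε : ℤ) : ℂ) * p ^ n * p) =
        p ^ n * (((ε : ℤ) * (p * if t = 0 then (p : ℤ) - 1 else -1) : ℤ) : ℂ)
    rw [sum_congr rfl this, ← sum_mul, h0]
    push_cast; ring

variable {n : ℕ}

lemma zeroCount_of_isKind (hp : p ≠ 2) (hF : Fintype.card F = p ^ (2 * n)) {x : F × F}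
    {κ : Fin 3 × ℤˣ} (hκ : IsKind σ n x κ) (z : F) (h : ZMod p) :
    (p : ℤ) * zeroCount σ x (polarMap σ x.1 x.2 z) h =
      p ^ (2 * n) + p ^ n * excess κ (h - frobForm σ x.1 x.2 z) := by
  have h1 := mul_zeroCount σ x (polarMap σ x.1 x.2 z) h
  rw [sum_congr rfl (fun y hy => (?_ : _ = ZMod.stdAddChar (y * (h - frobForm σ x.1 x.2 z)) *
      (quadCharC p y ^ (κ.1 : ℕ) * ((κ.2 : ℤ) : ℂ) * p ^ n * kindConst p κ.1))),
    sum_stdAddChar_mul_kind hp, hF] at h1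
  · exact_mod_cast h1
  · rw [← polarMap_smul, expSum_polarMap, hκ.expSum_smul y (mem_erase.mp hy).1, ← mul_assoc,
      ← AddChar.map_add_eq_mul, frobForm_smul]
    congr 2; ring

/-- For `y ≠ 0`, scaling by `y` scales the polar map, so `y • c` stays outside the range and every
nontrivial exponential sum vanishes. -/
lemma zeroCount_of_notMem_range (hp : p ≠ 2) (hF : Fintype.card F = p ^ (2 * n)) {x : F × F}
    {c : F} (hc : c ∉ LinearMap.range (polarMap σ x.1 x.2)) (h : ZMod p) :
    (p : ℤ) * zeroCount σ x c h = p ^ (2 * n) := by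
  have h1 := mul_zeroCount σ x c h
  rw [sum_eq_zero, hF, add_zero] at h1
  · exact_mod_cast h1
  · intro y hy
    have hy0 := (mem_erase.mp hy).1
    rw [expSum_eq_zero_of_notMem_range σ hp, mul_zero]
    rintro ⟨z, hz⟩
    refine hc ⟨z, ?_⟩
    rw [polarMap_smul] at hz
    exact smul_right_injective _ hy0 hz

lemma zeroCount_zero (h : ZMod p) :
    zeroCount σ 0 0 h = if h = 0 then Fintype.card F else 0 := by
  simp only [zeroCount, Prod.fst_zero, Prod.snd_zero, zero_mul, add_zero, map_zero, zero_add]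
  split_ifs with hh <;> simp [hh]

/-- The number of constant terms realising a given deviation of the number of zeros. -/
def excessCount (p : ℕ) [Fact p.Prime] (κ : Fin 3 × ℤˣ) (e : ℤ) : ℕ :=
  #{t : ZMod p | excess κ t = e}

lemma mul_zeroCount_eq_iff (hn : (p : ℤ) ^ n ≠ 0) {Z e E : ℤ}
    (h : Z = p ^ (2 * n) + p ^ n * E) : Z = p ^ (2 * n) + p ^ n * e ↔ E = e := by
  rw [h, add_right_inj, mul_right_inj' hn]

/-- For `c` in the range, completing the square only shifts the constant term, so `excessCount`
constants qualify. For `c` outside it, all `p` constants have deviation 0. -/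
lemma card_filter_zeroCount_of_ne_zero (hp : p ≠ 2) (hF : Fintype.card F = p ^ (2 * n)) {x : F × F}
    {κ : Fin 3 × ℤˣ} (hκ : IsKind σ n x κ) (e : ℤ) :
    (#{w : F × ZMod p | (p : ℤ) * zeroCount σ x w.1 w.2 = p ^ (2 * n) + p ^ n * e} : ℚ) =
      (p : ℚ) ^ (2 * n) / p ^ (κ.1 : ℕ) * excessCount p κ e +
        if e = 0 then ((p : ℚ) ^ (2 * n) - (p : ℚ) ^ (2 * n) / p ^ (κ.1 : ℕ)) * p else 0 := by
  classical
  have hp0 : p ≠ 0 := (Fact.out : p.Prime).ne_zero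
  have hpn : (p : ℤ) ^ n ≠ 0 := pow_ne_zero _ (by exact_mod_cast hp0)
  have h1 : ∀ c : F, #{h : ZMod p | (p : ℤ) * zeroCount σ x c h = p ^ (2 * n) + p ^ n * e} =
      if c ∈ LinearMap.range (polarMap σ x.1 x.2) then excessCount p κ e
        else if e = 0 then p else 0 := by
    intro c
    split_ifs with hc he
    · obtain ⟨z, rfl⟩ := hc
      simp_rw [mul_zeroCount_eq_iff hpn (zeroCount_of_isKind σ hp hF hκ z _)]
      exact card_equiv (Equiv.subRight (frobForm σ x.1 x.2 z)) (by simp)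
    · simp [zeroCount_of_notMem_range σ hp hF hc, he, ZMod.card]
    · simp [zeroCount_of_notMem_range σ hp hF hc, he, hp0]
  have h2 : #{w : F × ZMod p | (p : ℤ) * zeroCount σ x w.1 w.2 = p ^ (2 * n) + p ^ n * e} =
      ∑ c : F, #{h : ZMod p | (p : ℤ) * zeroCount σ x c h = p ^ (2 * n) + p ^ n * e} := by
    simp_rw [card_filter]
    exact Fintype.sum_prod_type _
  have h3 : (#{c : F | c ∈ LinearMap.range (polarMap σ x.1 x.2)} : ℚ) =
      (p : ℚ) ^ (2 * n) / p ^ (κ.1 : ℕ) := by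
    have := card_range_mul_card_ker σ x.1 x.2
    rw [hκ.card_ker, hF, Nat.card_eq_fintype_card, Fintype.card_subtype] at this
    rw [eq_div_iff (pow_ne_zero _ (by exact_mod_cast hp0))]
    exact_mod_cast this
  have h4 : (#{c : F | ¬ c ∈ LinearMap.range (polarMap σ x.1 x.2)} : ℚ) =
      (p : ℚ) ^ (2 * n) - (p : ℚ) ^ (2 * n) / p ^ (κ.1 : ℕ) := by
    have := card_filter_add_card_filter_not (s := (univ : Finset F))
      (fun c => c ∈ LinearMap.range (polarMap σ x.1 x.2))
    rw [card_univ, hF] at this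
    rw [← h3, eq_sub_iff_add_eq']
    exact_mod_cast this
  rw [h2, sum_congr rfl fun c _ => h1 c, sum_ite, sum_const, sum_const]
  simp only [smul_eq_mul, Nat.cast_add, Nat.cast_mul, h3, h4]
  split_ifs <;> simp

/-- The words with `a = b = 0` have deviation 0 if `c ≠ 0`. For `c = 0` they are constant, and
`he1`, `he2` exclude exactly their deviations. -/
lemma card_filter_zeroCount_zero (hp : p ≠ 2) (hF : Fintype.card F = p ^ (2 * n)) {e : ℤ}
    (he1 : e ≠ (p - 1) * p ^ n) (he2 : e ≠ - p ^ n) :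
    (#{w : F × ZMod p | (p : ℤ) * zeroCount σ 0 w.1 w.2 = p ^ (2 * n) + p ^ n * e} : ℚ) =
      if e = 0 then ((p : ℚ) ^ (2 * n) - 1) * p else 0 := by
  classical
  have hp0 : p ≠ 0 := (Fact.out : p.Prime).ne_zero
  have hpn : (p : ℤ) ^ n ≠ 0 := pow_ne_zero _ (by exact_mod_cast hp0)
  have h1 : ∀ c : F, #{h : ZMod p | (p : ℤ) * zeroCount σ 0 c h = p ^ (2 * n) + p ^ n * e} =
      if c = 0 then 0 else if e = 0 then p else 0 := by
    intro c
    by_cases hc : c = 0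
    · subst hc
      rw [if_pos rfl, card_eq_zero, filter_eq_empty_iff]
      intro h _ hh
      rw [zeroCount_zero, hF] at hh
      split_ifs at hh
      · refine he1 (mul_left_cancel₀ hpn ?_)
        push_cast at hh
        linear_combination -hh
      · refine he2 (mul_left_cancel₀ hpn ?_)
        push_cast at hh
        linear_combination -hh
    · have hc' : c ∉ LinearMap.range (polarMap σ (0 : F × F).1 (0 : F × F).2) := by
        rintro ⟨z, hz⟩
        rw [polarMap_apply] at hz
        simp at hz
        exact hc hz.symm
      rw [if_neg hc]
      split_ifs with he
      · simp [zeroCount_of_notMem_range σ hp hF hc', he, ZMod.card]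
      · simp [zeroCount_of_notMem_range σ hp hF hc', he, hp0]
  have h2 : #{w : F × ZMod p | (p : ℤ) * zeroCount σ 0 w.1 w.2 = p ^ (2 * n) + p ^ n * e} =
      ∑ c : F, #{h : ZMod p | (p : ℤ) * zeroCount σ 0 c h = p ^ (2 * n) + p ^ n * e} := by
    simp_rw [card_filter]
    exact Fintype.sum_prod_type _
  rw [h2, sum_congr rfl fun c _ => h1 c, sum_ite, sum_const, sum_const, filter_ne' univ (0 : F),
    card_erase_of_mem (mem_univ _), card_univ, hF]
  simp only [smul_eq_mul, Nat.cast_mul, mul_zero, zero_add]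
  rw [Nat.cast_sub (Nat.one_le_pow (2 * n) p (Nat.pos_of_ne_zero hp0))]
  split_ifs <;> simp

/-- The number of words whose number of zeros deviates in a given way. -/
theorem card_filter_zeroCount (hp : p ≠ 2) (hn : 1 ≤ n) (hF : Fintype.card F = p ^ (2 * n))
    (hσ : ∀ x, σ x = x → ∃ k : ZMod p, algebraMap (ZMod p) F k = x) {e : ℤ}
    (he1 : e ≠ (p - 1) * p ^ n) (he2 : e ≠ - p ^ n) :
    (#{v : (F × F) × F × ZMod p | (p : ℤ) * zeroCount σ v.1 v.2.1 v.2.2 =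
      p ^ (2 * n) + p ^ n * e} : ℚ) =
    (if e = 0 then ((p : ℚ) ^ (2 * n) - 1) * p else 0) + ∑ κ, kindCount σ n κ *
      ((p : ℚ) ^ (2 * n) / p ^ (κ.1 : ℕ) * excessCount p κ e +
        if e = 0 then ((p : ℚ) ^ (2 * n) - (p : ℚ) ^ (2 * n) / p ^ (κ.1 : ℕ)) * p else 0) := by
  classical
  have h2 : #{v : (F × F) × F × ZMod p | (p : ℤ) * zeroCount σ v.1 v.2.1 v.2.2 =
      p ^ (2 * n) + p ^ n * e} = ∑ x : F × F,
      #{w : F × ZMod p | (p : ℤ) * zeroCount σ x w.1 w.2 = p ^ (2 * n) + p ^ n * e} := by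
    simp_rw [card_filter]
    exact Fintype.sum_prod_type _
  rw [h2, Nat.cast_sum, ← add_sum_erase _ _ (mem_univ (0 : F × F)),
    card_filter_zeroCount_zero σ hp hF he1 he2, ← sum_kindOf]
  congr 1
  refine sum_congr rfl fun x hx => ?_
  exact card_filter_zeroCount_of_ne_zero σ hp hF
    (isKind_kindOf σ hp hn hF hσ (mem_erase.mp hx).1) e

/-- The quadratic character sums to zero and vanishes only at 0. -/
lemma card_quadraticChar_eq (hp : p ≠ 2) (ε : ℤˣ) :
    (#{t : ZMod p | quadraticChar (ZMod p) (-t) = ε} : ℚ) = (p - 1) / 2 := by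
  have h0 : ∑ t : ZMod p, quadraticChar (ZMod p) (-t) = 0 := by
    rw [← quadraticChar_sum_zero (ringChar_zmod_ne_two hp)]
    exact Equiv.sum_comp (Equiv.neg (ZMod p)) _
  have h1 : ∀ t : ZMod p, quadraticChar (ZMod p) (-t) =
      (if quadraticChar (ZMod p) (-t) = 1 then 1 else 0) -
      (if quadraticChar (ZMod p) (-t) = -1 then 1 else 0) := by
    intro t
    by_cases ht : -t = 0
    · rw [ht]; simp
    · rcases quadraticChar_dichotomy ht with h | h <;> simp [h]
  have h2 : ∀ t : ZMod p, 1 = (if quadraticChar (ZMod p) (-t) = 1 then 1 else 0) +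
      (if quadraticChar (ZMod p) (-t) = -1 then 1 else 0) + if t = 0 then 1 else 0 := by
    intro t
    by_cases ht : t = 0
    · rw [ht]; simp
    · rcases quadraticChar_dichotomy (neg_ne_zero.mpr ht) with h | h <;> simp [h, ht]
  have h3 : p = #{t : ZMod p | quadraticChar (ZMod p) (-t) = 1} +
      #{t : ZMod p | quadraticChar (ZMod p) (-t) = -1} + 1 := by
    have : ∑ t : ZMod p, 1 = _ := sum_congr rfl fun t _ => h2 t
    rw [sum_add_distrib, sum_add_distrib, ← card_filter, ← card_filter] at this
    simpa [ZMod.card] using this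
  rw [sum_congr rfl fun t _ => h1 t, sum_sub_distrib, sum_boole, sum_boole] at h0
  have h4 : (#{t : ZMod p | quadraticChar (ZMod p) (-t) = 1} : ℚ) =
      #{t : ZMod p | quadraticChar (ZMod p) (-t) = -1} := by exact_mod_cast sub_eq_zero.mp h0
  have h5 := congrArg (Nat.cast (R := ℚ)) h3
  push_cast at h5
  rcases Int.units_eq_one_or ε with rfl | rfl
  · push_cast; linarith
  · push_cast; linarith

end ZeroCounts

/-! ### The weight distribution -/

section WordCounts

variable {p : ℕ} [Fact p.Prime]

lemma card_filter_eq_ite (f : ZMod p → ℤ) (A B e : ℤ) (h0 : f 0 = A)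
    (h : ∀ t, t ≠ 0 → f t = B) : (#{t | f t = e} : ℚ) =
      (if A = e then 1 else 0) + if B = e then (p : ℚ) - 1 else 0 := by
  have hp1 : 1 ≤ p := (Fact.out : p.Prime).one_le
  rw [card_filter, ← add_sum_erase _ _ (mem_univ (0 : ZMod p)), h0,
    sum_congr rfl fun t ht => by rw [h t (mem_erase.mp ht).1], sum_const,
    card_erase_of_mem (mem_univ _), card_univ, ZMod.card]
  split_ifs <;> simp [Nat.cast_sub hp1]

lemma excessCount_corank_zero (ε : ℤˣ) (e : ℤ) : (excessCount p (0, ε) e : ℚ) =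
    (if ε * ((p : ℤ) - 1) = e then 1 else 0) + if -(ε : ℤ) = e then (p : ℚ) - 1 else 0 :=
  card_filter_eq_ite _ _ _ _ (by simp [excess]) fun t ht => by simp [excess, ht]

lemma excessCount_corank_two (ε : ℤˣ) (e : ℤ) : (excessCount p (2, ε) e : ℚ) =
    (if ε * ((p : ℤ) * (p - 1)) = e then 1 else 0) +
      if -(ε * (p : ℤ)) = e then (p : ℚ) - 1 else 0 :=
  card_filter_eq_ite _ _ _ _ (by simp [excess]) fun t ht => by simp [excess, ht]

/-- The type only exchanges squares and nonsquares, which are equally many. Hence only the sum of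
the two corank-one frequencies is ever needed. -/
lemma excessCount_corank_one (hp : p ≠ 2) (ε : ℤˣ) (e : ℤ) : (excessCount p (1, ε) e : ℚ) =
    (if e = 0 then 1 else 0) + if e = p ∨ e = -p then ((p : ℚ) - 1) / 2 else 0 := by
  have hp0 : (p : ℤ) ≠ 0 := by exact_mod_cast (Fact.out : p.Prime).ne_zero
  have hex : ∀ t : ZMod p, excess (1, ε) t = ε * (p * quadraticChar (ZMod p) (-t)) := fun _ => rfl
  have hε : (ε : ℤ) ≠ 0 := ε.ne_zero
  have hval : ∀ t : ZMod p, t ≠ 0 → quadraticChar (ZMod p) (-t) = 1 ∨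
      quadraticChar (ZMod p) (-t) = -1 := fun t ht => quadraticChar_dichotomy (neg_ne_zero.mpr ht)
  unfold excessCount
  simp_rw [hex]
  by_cases h0 : e = 0
  · subst h0
    have : (univ.filter fun t : ZMod p => (ε : ℤ) * (p * quadraticChar (ZMod p) (-t)) = 0) = {0} := by
      ext t
      rw [mem_filter, mul_eq_zero, mul_eq_zero, quadraticChar_eq_zero_iff, neg_eq_zero]
      simp [(Fact.out : p.Prime).ne_zero]
    rw [this, if_pos rfl, if_neg (by omega)]
    simp
  rw [if_neg h0, zero_add]
  have key : ∀ δ : ℤˣ, e = δ * p →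
      (univ.filter fun t : ZMod p => (ε : ℤ) * (p * quadraticChar (ZMod p) (-t)) = e) =
        univ.filter fun t : ZMod p => quadraticChar (ZMod p) (-t) = (ε * δ : ℤˣ) := by
    rintro δ rfl
    ext t
    simp only [mem_filter, mem_univ, true_and, Units.val_mul]
    have hε2 : (ε : ℤ) * ε = 1 := by rw [← Units.val_mul, Int.units_mul_self, Units.val_one]
    constructor
    · intro h
      refine mul_left_cancel₀ hp0 (mul_left_cancel₀ hε ?_)
      linear_combination h - p * δ * hε2
    · intro h
      rw [h]
      linear_combination p * δ * hε2
  by_cases h1 : e = p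
  · rw [if_pos (Or.inl h1), key 1 (by simpa using h1), card_quadraticChar_eq hp]
  by_cases h2 : e = -p
  · rw [if_pos (Or.inr h2), key (-1) (by simpa using h2), card_quadraticChar_eq hp]
  · rw [if_neg (by tauto), filter_eq_empty_iff.mpr, card_empty, Nat.cast_zero]
    intro t _ ht
    by_cases htz : t = 0
    · subst htz; simp at ht; exact h0 ht.symm
    · rcases Int.units_eq_one_or ε with rfl | rfl <;> rcases hval t htz with h | h <;>
        rw [h] at ht <;> simp at ht <;> omega

variable {F : Type*} [Field F] [Fintype F] [Algebra (ZMod p) F] {σ : F ≃ₐ[ZMod p] F} {n : ℕ}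

variable (σ) in
/-- The number of words `(a, b, c, h)` whose number of zeros has deviation `e`. -/
def wordCount (n : ℕ) (e : ℤ) : ℕ :=
  #{v : (F × F) × F × ZMod p | (p : ℤ) * zeroCount σ v.1 v.2.1 v.2.2 = p ^ (2 * n) + p ^ n * e}

/-- As `p ≥ 3`, the values `0, ±1, ±(p - 1), ±p, ±p(p - 1)` are distinct, and only `±p` comes from
two coranks. As `n ≥ 2`, none of them is the deviation of a constant word. -/
lemma wordCount_eq (hp : p ≠ 2) (hn : 2 ≤ n) (hF : Fintype.card F = p ^ (2 * n))
    (hσ : ∀ x, σ x = x → ∃ k : ZMod p, algebraMap (ZMod p) F k = x) {q : ℚ}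
    (hq : q = p ^ (2 * n)) (ε : ℤˣ) :
    (wordCount σ n (ε * (p - 1)) : ℚ) = q * kindCount σ n (0, ε) ∧
    (wordCount σ n (-ε) : ℚ) = q * (p - 1) * kindCount σ n (0, ε) ∧
    (wordCount σ n (ε * (p * (p - 1))) : ℚ) = q / p ^ 2 * kindCount σ n (2, ε) ∧
    (wordCount σ n (-(ε * p)) : ℚ) = q / p ^ 2 * (p - 1) * kindCount σ n (2, ε) +
      q / p * ((p - 1) / 2) * (kindCount σ n (1, 1) + kindCount σ n (1, -1)) ∧
    (wordCount σ n 0 : ℚ) = (q - 1) * p +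
      (q / p + (q - q / p) * p) * (kindCount σ n (1, 1) + kindCount σ n (1, -1)) +
      (q - q / p ^ 2) * p * (kindCount σ n (2, 1) + kindCount σ n (2, -1)) := by
  have hp3 : (3 : ℤ) ≤ p := by
    have := (Fact.out : p.Prime).two_le
    omega
  have hM0 : (p : ℤ) * 2 ≤ p * (p - 1) := mul_le_mul_of_nonneg_left (by omega) (by omega)
  have hpn : (p : ℤ) * p ≤ p ^ n := by
    rw [← sq]; exact pow_le_pow_right₀ (by omega) hn
  have hpn1 : ((p : ℤ) - 1) * p ≤ (p - 1) * p ^ n := by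
    refine mul_le_mul_of_nonneg_left ?_ (by omega)
    nlinarith
  have hpn2 : (p : ℤ) * (p - 1) < (p - 1) * p ^ n := by nlinarith
  have hpp : (p : ℤ) * p = p * (p - 1) + p := by ring
  rw [hpp] at hpn
  have main : ∀ e : ℤ, e ≠ (p - 1) * p ^ n → e ≠ -p ^ n → (wordCount σ n e : ℚ) = _ :=
    fun e h1 h2 => card_filter_zeroCount σ hp (by omega : 1 ≤ n) hF hσ h1 h2
  simp only [sum_kind, excessCount_corank_zero, excessCount_corank_one hp,
    excessCount_corank_two, ← hq, Fin.val_zero, Fin.val_one, Fin.val_two, pow_zero, pow_one,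
    div_one, Units.val_one, Units.val_neg, one_mul, neg_mul, neg_neg] at main
  -- The products become atoms, and the linear bounds above suffice for `omega` to tell the values
  -- apart.
  generalize (p : ℤ) * (p - 1) = M at *
  generalize (p : ℤ) ^ n = P at *
  generalize ((p : ℤ) - 1) * P = PP at *
  refine ⟨?_, ?_, ?_, ?_, ?_⟩
  rotate_right
  · rw [main 0 (by omega) (by omega)]
    simp (disch := omega) only [if_neg, if_true]
    ring
  all_goals
    rcases Int.units_eq_one_or ε with rfl | rfl
    all_goals
      simp only [Units.val_one, Units.val_neg, one_mul, neg_mul, neg_neg]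
      rw [main _ (by omega) (by omega)]
      simp (disch := omega) only [if_neg, true_or, or_true, if_true]
      ring

lemma excess_le (hp : p ≠ 2) (κ : Fin 3 × ℤˣ) (t : ZMod p) : excess κ t ≤ p * (p - 1) := by
  have hp3 : (3 : ℤ) ≤ p := by
    have := (Fact.out : p.Prime).two_le
    omega
  have hM : (p : ℤ) * 2 ≤ p * (p - 1) := mul_le_mul_of_nonneg_left (by omega) (by omega)
  have hχ : quadraticChar (ZMod p) (-t) = 0 ∨ quadraticChar (ZMod p) (-t) = 1 ∨
      quadraticChar (ZMod p) (-t) = -1 := by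
    by_cases ht : -t = 0
    · left; rw [ht]; simp
    · exact Or.inr (quadraticChar_dichotomy ht)
  obtain ⟨k, ε⟩ := κ
  have h0 : excess (0, ε) t = ε * (if t = 0 then (p : ℤ) - 1 else -1) := rfl
  have h1 : excess (1, ε) t = ε * (p * quadraticChar (ZMod p) (-t)) := rfl
  have h2 : excess (2, ε) t = ε * (p * if t = 0 then (p : ℤ) - 1 else -1) := rfl
  rcases Int.units_eq_one_or ε with rfl | rfl
  · fin_cases k
    · change excess (0, 1) t ≤ _
      rw [h0, Units.val_one]; split_ifs <;> omega
    · change excess (1, 1) t ≤ _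
      rw [h1, Units.val_one]
      rcases hχ with h | h | h <;> rw [h] <;> omega
    · change excess (2, 1) t ≤ _
      rw [h2, Units.val_one]; split_ifs <;> omega
  · fin_cases k
    · change excess (0, -1) t ≤ _
      rw [h0, Units.val_neg, Units.val_one]; split_ifs <;> omega
    · change excess (1, -1) t ≤ _
      rw [h1, Units.val_neg, Units.val_one]
      rcases hχ with h | h | h <;> rw [h] <;> omega
    · change excess (2, -1) t ≤ _
      rw [h2, Units.val_neg, Units.val_one]; split_ifs <;> omega

/-- A nonzero word has few zeros. -/
lemma mul_zeroCount_le (hp : p ≠ 2) (hn : 1 ≤ n) (hF : Fintype.card F = p ^ (2 * n))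
    (hσ : ∀ x, σ x = x → ∃ k : ZMod p, algebraMap (ZMod p) F k = x) {x : F × F} {c : F}
    {h : ZMod p} (hx : ¬ (x = 0 ∧ c = 0 ∧ h = 0)) :
    (p : ℤ) * zeroCount σ x c h ≤ p ^ (2 * n) + p ^ n * (p * (p - 1)) := by
  have hp1 : (1 : ℤ) ≤ p := by exact_mod_cast (Fact.out : p.Prime).one_le
  have hpos : (0 : ℤ) ≤ p ^ n * (p * (p - 1)) :=
    mul_nonneg (by positivity) (mul_nonneg (by omega) (by omega))
  by_cases hc : c ∈ LinearMap.range (polarMap σ x.1 x.2)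
  · by_cases hx0 : x = 0
    · subst hx0
      obtain ⟨z, rfl⟩ := hc
      have hz : polarMap σ (0 : F × F).1 (0 : F × F).2 z = 0 := by simp [polarMap_apply]
      rw [hz] at hx ⊢
      rw [zeroCount_zero, if_neg (by tauto)]
      simp only [Nat.cast_zero, mul_zero]
      positivity
    · obtain ⟨z, rfl⟩ := hc
      rw [zeroCount_of_isKind σ hp hF (isKind_kindOf σ hp hn hF hσ hx0)]
      have := excess_le hp (kindOf σ n x) (h - frobForm σ x.1 x.2 z)
      gcongr
  · rw [zeroCount_of_notMem_range σ hp hF hc]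
    omega

end WordCounts

/-! ### Designs from doubly transitive codes -/

section Designs

variable {K : Type*} [Field K] [Fintype K] [DecidableEq K] {ι : Type*} [Fintype ι] [DecidableEq ι]

/-- The words with a given support are the nonzero multiples of one of them. -/
lemma card_words_eq_mul_card_supports {W : Finset (ι → K)}
    (hsmul : ∀ c ∈ W, ∀ μ : K, μ ≠ 0 → μ • c ∈ W) (h0 : 0 ∉ W)
    (hprop : ∀ c ∈ W, ∀ c' ∈ W, (∀ x, c x = 0 ↔ c' x = 0) → ∃ μ : K, c' = μ • c) :
    #W = #(W.image fun c => univ.filter fun j => c j ≠ 0) * (Fintype.card K - 1) := by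
  rw [card_eq_sum_card_image (fun c => univ.filter fun j => c j ≠ 0) W, sum_const_nat]
  intro B hB
  obtain ⟨c, hc, rfl⟩ := mem_image.mp hB
  have hc0 : c ≠ 0 := fun h => h0 (h ▸ hc)
  have : (W.filter fun a => (univ.filter fun j => a j ≠ 0) = univ.filter fun j => c j ≠ 0) =
      (univ.erase (0 : K)).image fun μ => μ • c := by
    ext a
    simp only [mem_filter, mem_image, mem_erase, mem_univ, and_true]
    constructor
    · rintro ⟨ha, h⟩
      obtain ⟨μ, rfl⟩ := hprop c hc a ha fun x => by
        have := Finset.ext_iff.mp h x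
        simp only [mem_filter, mem_univ, true_and] at this
        tauto
      refine ⟨μ, ?_, rfl⟩
      rintro rfl
      rw [zero_smul] at ha
      exact h0 ha
    · rintro ⟨μ, hμ, rfl⟩
      refine ⟨hsmul c hc μ hμ, ?_⟩
      ext x; simp [hμ]
  rw [this, card_image_of_injective _ (smul_left_injective K hc0), card_erase_of_mem (mem_univ _),
    card_univ]

/-- Double counting of the pairs `T ⊆ B`. -/
lemma choose_two_mul_eq {S : Finset (Finset ι)} {k r : ℕ} (hS : ∀ B ∈ S, #B = k)
    (hr : ∀ T : Finset ι, #T = 2 → #{B ∈ S | T ⊆ B} = r) :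
    (Fintype.card ι).choose 2 * r = #S * k.choose 2 := by
  have h := sum_card_bipartiteAbove_eq_sum_card_bipartiteBelow
    (s := powersetCard 2 (univ : Finset ι)) (t := S) (fun T B => T ⊆ B)
  rw [sum_const_nat (m := r), sum_const_nat (m := k.choose 2), card_powersetCard, card_univ] at h
  · exact h
  · intro B hB
    rw [← hS B hB, ← card_powersetCard]
    congr 1
    ext T
    simp only [bipartiteBelow, mem_filter, mem_powersetCard, subset_univ, true_and]
    tauto
  · intro T hT
    exact hr T (mem_powersetCard.mp hT).2

/-- A code with a doubly transitive automorphism group, in which the support determines a word of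
weight `k` up to a scalar, holds a `2`-design. -/
theorem holdsDesign_of_doublyTransitive (C : Submodule K (ι → K)) {k : ℕ} (hk2 : 2 < k)
    (hkv : k < Fintype.card ι) {A : ℕ} (hA : Nat.card {c // c ∈ C ∧ hammingNorm c = k} = A)
    (hA0 : 0 < A)
    (htrans : ∀ i j i' j' : ι, i ≠ j → i' ≠ j' → ∃ π : Equiv.Perm ι, π i = i' ∧ π j = j' ∧
      ∀ c ∈ C, (fun x => c (π x)) ∈ C)
    (hprop : ∀ c ∈ C, ∀ c' ∈ C, hammingNorm c = k → (∀ x, c x = 0 ↔ c' x = 0) →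
      ∃ μ : K, c' = μ • c) {i lam : ℚ} (hi : k = i)
    (hlam : (A : ℚ) * (i * (i - 1)) =
      lam * ((Fintype.card K - 1) * (Fintype.card ι * (Fintype.card ι - 1)))) :
    HoldsDesign C 2 (Fintype.card ι) i lam := by
  classical
  set W : Finset (ι → K) := univ.filter fun c => c ∈ C ∧ hammingNorm c = k with hW
  have hWA : #W = A := by rw [← hA, Nat.card_eq_fintype_card, Fintype.card_subtype]
  have hK : 1 < Fintype.card K := Fintype.one_lt_card
  set S := W.image fun c => univ.filter fun j => c j ≠ 0 with hSdef
  have hWS : #W = #S * (Fintype.card K - 1) := by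
    refine card_words_eq_mul_card_supports ?_ ?_ ?_
    · intro c hc μ hμ
      simp only [hW, mem_filter, mem_univ, true_and] at hc ⊢
      refine ⟨C.smul_mem μ hc.1, ?_⟩
      rw [hammingNorm_smul (fun _ => IsSMulRegular.of_ne_zero hμ)]
      exact hc.2
    · simp [hW]; omega
    · intro c hc c' hc' h
      simp only [hW, mem_filter, mem_univ, true_and] at hc hc'
      exact hprop c hc.1 c' hc'.1 hc.2 h
  have hmemS : ∀ B, B ∈ S ↔ B ∈ supportsOfWeight C k := by
    intro B
    simp only [hSdef, hW, mem_image, mem_filter, mem_univ, true_and, supportsOfWeight,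
      Set.mem_ofPred_eq, and_assoc]
    simp only [eq_comm]
  have hScard : ∀ B ∈ S, #B = k := by
    intro B hB
    obtain ⟨c, hc, rfl⟩ := mem_image.mp hB
    exact (mem_filter.mp hc).2.2
  -- Blocks through `T` are carried injectively to blocks through `T'` by the inverse of a
  -- permutation taking `T'` to `T`. Exchanging `T` and `T'` gives equality.
  have hle : ∀ T T' : Finset ι, #T = 2 → #T' = 2 → #{B ∈ S | T ⊆ B} ≤ #{B ∈ S | T' ⊆ B} := by
    intro T T' hT hT'
    obtain ⟨a, b, hab, rfl⟩ := card_eq_two.mp hT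
    obtain ⟨a', b', hab', rfl⟩ := card_eq_two.mp hT'
    obtain ⟨π, hπa, hπb, hπ⟩ := htrans a' b' a b hab' hab
    refine card_le_card_of_injOn (fun B => B.map π.symm.toEmbedding) ?_
      ((map_injective _).injOn)
    intro B hB
    simp only [coe_filter, Set.mem_ofPred_eq] at hB ⊢
    obtain ⟨hBS, hB⟩ := hB
    obtain ⟨c, hc, rfl⟩ := mem_image.mp hBS
    simp only [hW, mem_filter, mem_univ, true_and] at hc
    have hmap : (univ.filter fun j => c j ≠ 0).map π.symm.toEmbedding =
        univ.filter fun j => c (π j) ≠ 0 := by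
      ext x
      simp [mem_map_equiv]
    have hsub : c a ≠ 0 ∧ c b ≠ 0 := by
      simpa [insert_subset_iff] using hB
    constructor
    · refine mem_image.mpr ⟨fun x => c (π x), ?_, hmap.symm⟩
      simp only [hW, mem_filter, mem_univ, true_and]
      refine ⟨hπ c hc.1, ?_⟩
      rw [← hc.2, hammingNorm, hammingNorm, ← hmap, card_map]
    · rw [hmap]
      simp [insert_subset_iff, hπa, hπb, hsub]
  obtain ⟨T₀, -, hT₀⟩ := exists_subset_card_eq (s := (univ : Finset ι)) (n := 2)
    (by rw [card_univ]; omega)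
  have hr : ∀ T : Finset ι, #T = 2 → #{B ∈ S | T ⊆ B} = #{B ∈ S | T₀ ⊆ B} :=
    fun T hT => le_antisymm (hle T T₀ hT hT₀) (hle T₀ T hT₀ hT)
  refine ⟨k, #{B ∈ S | T₀ ⊆ B}, hi, ?_, ?_, rfl, one_le_two, hk2, hkv, ?_, ?_⟩
  · have h1 := congrArg (Nat.cast (R := ℚ)) (choose_two_mul_eq hScard hr)
    push_cast [Nat.cast_choose_two] at h1
    have h2 := congrArg (Nat.cast (R := ℚ)) hWS
    rw [hWA, Nat.cast_mul, Nat.cast_sub hK.le, Nat.cast_one] at h2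
    have hv : ((Fintype.card ι : ℚ) * (Fintype.card ι - 1)) ≠ 0 := by
      have : (3 : ℚ) < Fintype.card ι := by exact_mod_cast (by omega : 3 < Fintype.card ι)
      exact mul_ne_zero (by linarith) (by linarith)
    have hK' : (Fintype.card K : ℚ) - 1 ≠ 0 := by
      have : (1 : ℚ) < Fintype.card K := by exact_mod_cast hK
      linarith
    refine mul_right_cancel₀ (mul_ne_zero hK' hv) ?_
    rw [← hlam, ← hi, h2]
    linear_combination 2 * ((Fintype.card K : ℚ) - 1) * h1
  · have : 0 < #W := by omega
    obtain ⟨c, hc⟩ := card_pos.mp this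
    exact ⟨c, (mem_filter.mp hc).2⟩
  · exact fun B hB => hScard B ((hmemS B).mpr hB)
  · intro T hT
    rw [← hr T hT, ← Set.ncard_coe_finset]
    congr 1
    ext B
    simp [← hmemS]

end Designs

/-! ### Duals and extensions -/

section DualCodes

variable {K : Type*} [Field K]

lemma mem_dualCode {ι : Type*} [Fintype ι] {C : Submodule K (ι → K)} {u : ι → K} :
    u ∈ dualCode C ↔ ∀ c ∈ C, ∑ i, u i * c i = 0 := Iff.rfl

/-- The dual is the orthogonal complement for the dot product, which is symmetric and nondegenerate.
-/
theorem dualCode_dualCode {ι : Type*} [Fintype ι] (C : Submodule K (ι → K)) :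
    dualCode (dualCode C) = C := by
  classical
  let B : LinearMap.BilinForm K (ι → K) := Matrix.toBilin' (1 : Matrix ι ι K)
  have hB : ∀ u v, B u v = ∑ i, v i * u i := fun u v => by
    simp only [B, Matrix.toBilin'_apply', Matrix.one_mulVec, dotProduct]
    exact sum_congr rfl fun i _ => mul_comm _ _
  have hnd : B.Nondegenerate :=
    LinearMap.BilinForm.nondegenerate_toBilin'_of_det_ne_zero' _ (by simp)
  have hrefl : B.IsRefl := fun u v h => by
    rw [hB] at h ⊢
    rw [← h]
    exact sum_congr rfl fun i _ => mul_comm _ _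
  have hdual : ∀ C : Submodule K (ι → K), dualCode C = B.orthogonal C := by
    intro C
    ext u
    rw [mem_dualCode, LinearMap.BilinForm.mem_orthogonal_iff]
    exact forall₂_congr fun c _ => by rw [hB]
  rw [hdual, hdual, LinearMap.BilinForm.orthogonal_orthogonal hnd hrefl]

lemma dualCode_anti {ι : Type*} [Fintype ι] {C D : Submodule K (ι → K)} (h : C ≤ D) :
    dualCode D ≤ dualCode C := fun _ hu c hc => hu c (h hc)

/-- The words whose coordinates, shifted by the last one, form a word of `C`. -/
lemma mem_dualCode_extendedCode_dualCode {n : ℕ} (C : Submodule K (Fin n → K))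
    (w : Fin (n + 1) → K) : w ∈ dualCode (extendedCode (dualCode C)) ↔
      (fun i : Fin n => w i.castSucc - w (Fin.last n)) ∈ C := by
  -- `D` consists of the words of `C` extended by 0, plus constants. Orthogonality to the constants
  -- is the zero-sum condition of the extended code.
  let D : Submodule K (Fin (n + 1) → K) := C.comap (LinearMap.pi fun i : Fin n =>
    LinearMap.proj (R := K) (φ := fun _ => K) i.castSucc - LinearMap.proj (Fin.last n))
  have hD : extendedCode (dualCode C) = dualCode D := by
    ext u
    constructor
    · rintro ⟨hu, hs⟩ w hw
      have hw' : (fun i : Fin n => w i.castSucc - w (Fin.last n)) ∈ C := hw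
      have h1 := hu _ hw'
      rw [Fin.sum_univ_castSucc] at hs ⊢
      simp only [mul_sub, sum_sub_distrib, ← sum_mul] at h1
      linear_combination h1 + w (Fin.last n) * hs
    · intro hu
      refine ⟨fun c hc => ?_, ?_⟩
      · have := hu (Fin.snoc c 0) (by
          change (fun i : Fin n => (Fin.snoc c 0 : Fin (n + 1) → K) i.castSucc -
            (Fin.snoc c 0 : Fin (n + 1) → K) (Fin.last n)) ∈ C
          simpa using hc)
        rw [Fin.sum_univ_castSucc] at this
        simpa using this
      · have := hu (fun _ => 1) (by
          change (fun i : Fin n => (1 : K) - 1) ∈ C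
          simp only [sub_self]
          exact C.zero_mem)
        simpa using this
  rw [hD, dualCode_dualCode]
  rfl

end DualCodes

/-! ### Cyclic codes as trace codes -/

section CyclicCodes

variable {p : ℕ} [Fact p.Prime] {F : Type*} [Field F] [Fintype F] [Algebra (ZMod p) F]

/-- Over `F` the polynomial `X ^ n - 1` is a product of pairwise coprime linear factors, and
divisibility descends to the prime field. -/
lemma X_pow_sub_one_dvd_iff {n : ℕ} (hn : 0 < n) {α : F} (hα : IsPrimitiveRoot α n)
    (f : (ZMod p)[X]) : X ^ n - 1 ∣ f ↔ ∀ x : F, x ^ n = 1 → aeval x f = 0 := by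
  constructor
  · rintro ⟨g, rfl⟩ x hx
    simp [hx]
  · intro h
    rw [← Polynomial.map_dvd_map' (algebraMap (ZMod p) F)]
    have : (X ^ n - 1 : (ZMod p)[X]).map (algebraMap (ZMod p) F) = X ^ n - 1 := by simp
    rw [this, X_pow_sub_one_eq_prod hn hα]
    refine Finset.prod_dvd_of_coprime ?_ fun x hx => ?_
    · exact fun x _ y _ hxy => pairwise_coprime_X_sub_C Function.injective_id hxy
    · rw [dvd_iff_isRoot, IsRoot.def, eval_map_algebraMap]
      exact h x ((mem_nthRootsFinset hn 1).mp hx)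

variable (p) in
/-- The word polynomial `∑ cᵢ Xⁱ` of a word. -/
def wordPoly {n : ℕ} (c : Fin n → ZMod p) : (ZMod p)[X] := ∑ i : Fin n, C (c i) * X ^ (i : ℕ)

lemma aeval_wordPoly {n : ℕ} (c : Fin n → ZMod p) (x : F) :
    aeval x (wordPoly p c) = ∑ i : Fin n, algebraMap (ZMod p) F (c i) * x ^ (i : ℕ) := by
  simp [wordPoly]

/-- After multiplication by `h`, membership says that `X ^ n - 1` divides `h` times the word
polynomial, which is tested at the `n`-th roots of unity. -/
lemma mem_cyclicCodeOfParityCheck {n : ℕ} (hn : 0 < n) {α : F} (hα : IsPrimitiveRoot α n)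
    {h : (ZMod p)[X]} (hh : h ∣ X ^ n - 1) (c : Fin n → ZMod p) :
    c ∈ cyclicCodeOfParityCheck n h ↔
      ∀ x : F, x ^ n = 1 → aeval x h ≠ 0 → aeval x (wordPoly p c) = 0 := by
  have h0 : h ≠ 0 := by
    rintro rfl
    have := monic_X_pow_sub_C (1 : ZMod p) hn.ne'
    rw [map_one, zero_dvd_iff.mp hh] at this
    exact not_monic_zero this
  have hmul : h * ((X ^ n - 1) / h) = X ^ n - 1 := EuclideanDomain.mul_div_cancel' h0 hh
  have : c ∈ cyclicCodeOfParityCheck n h ↔ (X ^ n - 1) / h ∣ wordPoly p c := Iff.rfl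
  rw [this, ← mul_dvd_mul_iff_left h0, hmul, X_pow_sub_one_dvd_iff hn hα]
  refine forall₂_congr fun x _ => ?_
  rw [map_mul, mul_eq_zero]
  tauto

/-- Inversion of the discrete Fourier transform. -/
lemma sum_aeval_mul_aeval_inv [DecidableEq F] {n : ℕ} (hn : n = Fintype.card F - 1)
    (c u : Fin n → ZMod p) :
    ∑ x : Fˣ, aeval (x : F) (wordPoly p c) * aeval ((x : F)⁻¹) (wordPoly p u) =
      - algebraMap (ZMod p) F (∑ i, u i * c i) := by
  have hx : ∀ x : Fˣ, (x : F) ^ n = 1 := fun x => by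
    rw [hn]; exact FiniteField.pow_card_sub_one_eq_one _ x.ne_zero
  have h1 : ∀ x : Fˣ, ∀ i k : Fin n, (x : F) ^ (k : ℕ) * ((x : F)⁻¹) ^ (i : ℕ) =
      (x : F) ^ (k + (n - i) : ℕ) := by
    intro x i k
    have : (x : F) ^ (n - i : ℕ) * (x : F) ^ (i : ℕ) = 1 := by
      rw [← pow_add, Nat.sub_add_cancel i.2.le, hx]
    rw [pow_add, inv_pow, inv_eq_of_mul_eq_one_left this]
  have h2 : ∀ i k : Fin n, ∑ x : Fˣ, (x : F) ^ (k : ℕ) * ((x : F)⁻¹) ^ (i : ℕ) =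
      if k = i then -1 else 0 := by
    intro i k
    simp_rw [h1, FiniteField.sum_pow_units, ← hn]
    -- The exponent `k + (n - i)` lies strictly between 0 and `2 n`, so `n` divides it only if `k =
    -- i`.
    refine if_congr ?_ rfl rfl
    have hk := k.2
    have hi := i.2
    constructor
    · rintro ⟨d, hd⟩
      have : d = 1 := by
        have h3 : n * d < n * 2 := by omega
        have h4 : 0 < n * d := by omega
        have := Nat.lt_of_mul_lt_mul_left h3
        have := Nat.pos_of_mul_pos_left h4
        omega
      subst this
      exact Fin.ext (by omega)
    · rintro rfl
      exact ⟨1, by omega⟩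
  simp_rw [aeval_wordPoly, sum_mul_sum]
  rw [sum_comm]
  calc _ = ∑ k : Fin n, ∑ i : Fin n, algebraMap (ZMod p) F (c k) * algebraMap (ZMod p) F (u i) *
        ∑ x : Fˣ, (x : F) ^ (k : ℕ) * ((x : F)⁻¹) ^ (i : ℕ) := by
        refine sum_congr rfl fun k _ => ?_
        rw [sum_comm]
        refine sum_congr rfl fun i _ => ?_
        rw [mul_sum]
        exact sum_congr rfl fun x _ => by ring
    _ = _ := by
        simp_rw [h2]
        simp only [mul_ite, mul_neg, mul_one, mul_zero, sum_ite_eq, mem_univ, if_true,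
          sum_neg_distrib, map_sum, map_mul]
        rw [neg_inj]
        exact sum_congr rfl fun i _ => mul_comm _ _

lemma aeval_wordPoly_algEquiv (τ : F ≃ₐ[ZMod p] F) {n : ℕ} (c : Fin n → ZMod p) (x : F) :
    aeval (τ x) (wordPoly p c) = τ (aeval x (wordPoly p c)) := by
  rw [← AlgEquiv.coe_toAlgHom, aeval_algHom_apply]

lemma aeval_minpoly_eq_zero_iff (x y : F) :
    aeval y (minpoly (ZMod p) x) = 0 ↔ ∃ τ : F ≃ₐ[ZMod p] F, y = τ x := by
  constructor
  · intro h
    obtain ⟨τ, hτ⟩ := minpoly.exists_algEquiv_of_root' (Algebra.IsAlgebraic.isAlgebraic x) h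
    exact ⟨τ, hτ.symm⟩
  · rintro ⟨τ, rfl⟩
    rw [← AlgEquiv.coe_toAlgHom, aeval_algHom_apply, minpoly.aeval, map_zero]

/-- The trace code with exponents in a finite set. -/
def traceCode (n : ℕ) (α : F) (E : Finset ℕ) : Submodule (ZMod p) (Fin n → ZMod p) where
  carrier := {c | ∃ a : ℕ → F, ∀ i : Fin n,
    c i = Algebra.trace (ZMod p) F (∑ e ∈ E, a e * ((α⁻¹) ^ (i : ℕ)) ^ e)}
  zero_mem' := ⟨fun _ => 0, fun i => by simp⟩
  add_mem' := by
    rintro c d ⟨a, ha⟩ ⟨b, hb⟩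
    exact ⟨fun e => a e + b e, fun i => by
      simp only [Pi.add_apply, ha, hb, add_mul, sum_add_distrib, map_add]⟩
  smul_mem' := by
    rintro r c ⟨a, ha⟩
    exact ⟨fun e => r • a e, fun i => by
      simp only [Pi.smul_apply, ha, smul_mul_assoc, ← smul_sum, map_smul]⟩

/-- A cyclic code whose parity-check polynomial has the conjugates of the `α ^ e` as roots is a
trace code. -/
theorem cyclicCodeOfParityCheck_eq_traceCode {n : ℕ} (hn : n = Fintype.card F - 1) (hn0 : 0 < n)
    {α : F} (hα : IsPrimitiveRoot α n) {h : (ZMod p)[X]} (hh : h ∣ X ^ n - 1) {E : Finset ℕ}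
    (hE : ∀ x : F, aeval x h = 0 ↔ ∃ e ∈ E, ∃ τ : F ≃ₐ[ZMod p] F, x = τ (α ^ e)) :
    cyclicCodeOfParityCheck n h = traceCode n α E := by
  classical
  have hα0 : α ≠ 0 := hα.ne_zero hn0.ne'
  apply le_antisymm
  -- Delsarte's argument: a word `u` orthogonal to the trace code vanishes at the inverses of the
  -- roots of `h`, and `c` vanishes at the other roots of unity. So every term of
  -- `sum_aeval_mul_aeval_inv` is zero.
  · rw [← dualCode_dualCode (cyclicCodeOfParityCheck n h), ← dualCode_dualCode (traceCode n α E)]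
    refine dualCode_anti fun u hu c hc => ?_
    have hroot : ∀ e ∈ E, aeval ((α⁻¹) ^ e) (wordPoly p u) = 0 := by
      intro e he
      refine (traceForm_nondegenerate (ZMod p) F).1 _ fun a => ?_
      have h1 := hu (fun i => Algebra.trace (ZMod p) F (a * ((α⁻¹) ^ (i : ℕ)) ^ e))
        ⟨fun e' => if e' = e then a else 0, fun i => by simp [he]⟩
      rw [Algebra.traceForm_apply, aeval_wordPoly, sum_mul, map_sum, ← h1]
      refine sum_congr rfl fun i _ => ?_
      rw [← smul_eq_mul (u i), ← map_smul, Algebra.smul_def]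
      congr 1
      rw [← pow_mul, ← pow_mul, mul_comm e]
      ring
    have h1 := sum_aeval_mul_aeval_inv hn c u
    rw [sum_eq_zero, eq_comm, neg_eq_zero] at h1
    · exact (algebraMap (ZMod p) F).injective (by rw [h1, map_zero])
    · intro x _
      have hx : (x : F) ^ n = 1 := by
        rw [hn]; exact FiniteField.pow_card_sub_one_eq_one _ x.ne_zero
      by_cases hxh : aeval (x : F) h = 0
      · obtain ⟨e, he, τ, hτ⟩ := (hE x).mp hxh
        rw [hτ, ← map_inv₀, ← inv_pow, aeval_wordPoly_algEquiv, aeval_wordPoly_algEquiv, hroot e he,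
          map_zero, mul_zero]
      · rw [(mem_cyclicCodeOfParityCheck hn0 hα hh c).mp hc x hx hxh, zero_mul]
  · rintro c ⟨a, ha⟩
    rw [mem_cyclicCodeOfParityCheck hn0 hα hh]
    intro x hx hxh
    rw [aeval_wordPoly]
    simp_rw [ha, trace_eq_sum_automorphisms, map_sum, sum_mul]
    rw [sum_comm]
    refine sum_eq_zero fun τ _ => ?_
    rw [sum_comm]
    refine sum_eq_zero fun e he => ?_
    -- The sum over the coordinates is geometric with ratio `y`; if `y = 1`, then `x` is conjugate
    -- to `α ^ e`, hence a root of `h`.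
    set y := τ ((α⁻¹) ^ e) * x with hy
    have hy1 : y ≠ 1 := by
      intro h1
      refine hxh ((hE x).mpr ⟨e, he, τ, ?_⟩)
      rw [hy, inv_pow, map_inv₀] at h1
      have : τ (α ^ e) ≠ 0 := by simp [hα0]
      field_simp at h1
      exact h1
    have hyn : y ^ n = 1 := by
      rw [hy, mul_pow, hx, mul_one, ← map_pow, ← pow_mul, mul_comm, pow_mul, inv_pow, hα.pow_eq_one]
      simp
    have hgeom : ∑ i : Fin n, y ^ (i : ℕ) = 0 := by
      rw [Fin.sum_univ_eq_sum_range (fun i => y ^ i)]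
      have := geom_sum_mul y n
      rw [hyn, sub_self] at this
      exact (mul_eq_zero.mp this).resolve_right (sub_ne_zero.mpr hy1)
    rw [← mul_zero (τ (a e)), ← hgeom, mul_sum]
    refine sum_congr rfl fun i _ => ?_
    rw [hy, map_mul, mul_pow, ← map_pow, ← pow_mul, ← pow_mul, mul_comm e]
    ring

end CyclicCodes

/-! ### Powers of Frobenius and the trace description of the code -/

section Frobenius

variable {p : ℕ} [Fact p.Prime] {F : Type*} [Field F] [Fintype F] [Algebra (ZMod p) F] {m : ℕ}

variable (p F) in
/-- The `l`-th power of the Frobenius automorphism. -/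
def frobPow (l : ℕ) : F ≃ₐ[ZMod p] F := FiniteField.frobeniusAlgEquivOfAlgebraic (ZMod p) F ^ l

lemma frobPow_apply (l : ℕ) (x : F) : frobPow p F l x = x ^ p ^ l := by
  rw [frobPow, AlgEquiv.coe_pow, FiniteField.coe_frobeniusAlgEquivOfAlgebraic_iterate, ZMod.card]

lemma finrank_eq_of_card (hF : Fintype.card F = p ^ m) : Module.finrank (ZMod p) F = m := by
  have := Module.card_eq_pow_finrank (K := ZMod p) (V := F)
  rw [hF, ZMod.card] at this
  exact (Nat.pow_right_injective (Fact.out : p.Prime).two_le this).symm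

lemma exists_eq_frobPow (hF : Fintype.card F = p ^ m) (τ : F ≃ₐ[ZMod p] F) :
    ∃ j < m, τ = frobPow p F j := by
  obtain ⟨j, hj⟩ :=
    (FiniteField.bijective_frobeniusAlgEquivOfAlgebraic_pow (ZMod p) F).2 τ
  exact ⟨j, finrank_eq_of_card (p := p) hF ▸ j.2, hj.symm⟩

lemma iterate_pow_apply (k : ℕ) (x : F) : (fun y : F => y ^ p)^[k] x = x ^ p ^ k := by
  rw [pow_iterate]

lemma isPeriodicPt_pow (hF : Fintype.card F = p ^ m) (x : F) :
    Function.IsPeriodicPt (fun y : F => y ^ p) m x := by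
  rw [Function.IsPeriodicPt, Function.IsFixedPt, iterate_pow_apply, ← hF, FiniteField.pow_card]

/-- Such an `x` has periods `m` and `l` under Frobenius, hence period 1, and the Galois group
consists of powers of Frobenius. -/
lemma exists_algebraMap_eq_of_frobPow_eq (hF : Fintype.card F = p ^ m) {l : ℕ}
    (hml : Nat.gcd m l = 1) (x : F) (hx : frobPow p F l x = x) :
    ∃ k : ZMod p, algebraMap (ZMod p) F k = x := by
  have h1 : Function.IsPeriodicPt (fun y : F => y ^ p) l x := by
    rw [Function.IsPeriodicPt, Function.IsFixedPt, iterate_pow_apply, ← frobPow_apply, hx]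
  have h2 := (isPeriodicPt_pow hF x).gcd h1
  rw [hml] at h2
  refine (IsGalois.mem_range_algebraMap_iff_fixed x).mpr fun τ => ?_
  obtain ⟨j, -, rfl⟩ := exists_eq_frobPow hF τ
  rw [frobPow_apply, ← iterate_pow_apply]
  have h3 := h2.mul_const j
  rwa [one_mul] at h3

lemma isCoprime_minpoly {x y : F} (h : ∀ τ : F ≃ₐ[ZMod p] F, y ≠ τ x) :
    IsCoprime (minpoly (ZMod p) x) (minpoly (ZMod p) y) := by
  rcases (minpoly.irreducible (Algebra.IsIntegral.isIntegral (R := ZMod p) x)).isCoprime_or_dvd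
    (minpoly (ZMod p) y) with h1 | h1
  · exact h1
  · exfalso
    have h2 : aeval x (minpoly (ZMod p) y) = 0 :=
      aeval_eq_zero_of_dvd_aeval_eq_zero h1 (minpoly.aeval _ _)
    obtain ⟨τ, hτ⟩ := (aeval_minpoly_eq_zero_iff y x).mp h2
    exact h τ.symm (by rw [hτ, AlgEquiv.symm_apply_apply])

variable {l : ℕ} {α : F}

lemma pow_frobenius_mod (hF : Fintype.card F = p ^ m) : α ^ p ^ l = α ^ p ^ (l % m) := by
  rw [← iterate_pow_apply, ← iterate_pow_apply, (isPeriodicPt_pow hF α).iterate_mod_apply]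

/-- The parity-check polynomial divides `X ^ n - 1`. -/
lemma minpoly_mul_minpoly_mul_minpoly_dvd (hp : p ≠ 2) (hm4 : 4 ≤ m) (hml : Nat.gcd m l = 1)
    (hF : Fintype.card F = p ^ m) (hα : IsPrimitiveRoot α (p ^ m - 1)) :
    minpoly (ZMod p) α * minpoly (ZMod p) (α ^ 2) * minpoly (ZMod p) (α ^ (p ^ l + 1)) ∣
      X ^ (p ^ m - 1) - 1 := by
  have hprime : p.Prime := Fact.out
  have hp3 : 3 ≤ p := by have := hprime.two_le; omega
  have hodd : Odd p := hprime.odd_of_ne_two hp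
  have hl0 : l % m ≠ 0 := by
    intro h
    have := Nat.gcd_eq_left (Nat.dvd_of_mod_eq_zero h)
    omega
  have hlm : l % m < m := Nat.mod_lt _ (by omega)
  have h27 : 27 ≤ p ^ (m - 1) :=
    calc 27 = 3 ^ 3 := by norm_num
      _ ≤ p ^ 3 := Nat.pow_le_pow_left hp3 3
      _ ≤ p ^ (m - 1) := Nat.pow_le_pow_right hprime.pos (by omega)
  have hpm : 3 * p ^ (m - 1) ≤ p ^ m := by
    rw [← Nat.sub_add_cancel (by omega : 1 ≤ m), pow_succ, Nat.add_sub_cancel, mul_comm]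
    exact Nat.mul_le_mul_left _ hp3
  have hbd : ∀ j < m, p ^ j ≤ p ^ (m - 1) := fun j hj =>
    Nat.pow_le_pow_right hprime.pos (by omega)
  have hdvd : ∀ e, minpoly (ZMod p) (α ^ e) ∣ X ^ (p ^ m - 1) - 1 := fun e => by
    refine minpoly.dvd _ _ ?_
    rw [map_sub, map_pow, aeval_X, map_one, ← pow_mul, mul_comm, pow_mul, hα.pow_eq_one, one_pow,
      sub_self]
  have hl := hbd _ hlm
  -- Reducing `l` modulo `m` brings all exponents below the order of `α`, so a conjugacy becomes an
  -- equality of integers. Parity excludes `2 = p ^ j` and `p ^ (l % m) + 1 = p ^ j`; divisibility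
  -- by `p`, with `l % m ≠ 0`, excludes `p ^ (l % m) + 1 = 2 p ^ j`.
  have hα3 : α ^ (p ^ l + 1) = α ^ (p ^ (l % m) + 1) := by
    rw [pow_succ, pow_succ, pow_frobenius_mod hF]
  have hodd' : ∀ j, Odd (p ^ j) := fun j => hodd.pow
  have h12 : IsCoprime (minpoly (ZMod p) α) (minpoly (ZMod p) (α ^ 2)) := by
    refine isCoprime_minpoly fun τ h => ?_
    obtain ⟨j, hj, rfl⟩ := exists_eq_frobPow hF τ
    have := hbd j hj
    rw [frobPow_apply] at h
    have := hα.pow_inj (by omega) (by omega) h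
    have := hodd' j
    rw [← ‹2 = p ^ j›] at this
    exact absurd this (by decide)
  have h13 : IsCoprime (minpoly (ZMod p) α) (minpoly (ZMod p) (α ^ (p ^ l + 1))) := by
    refine isCoprime_minpoly fun τ h => ?_
    obtain ⟨j, hj, rfl⟩ := exists_eq_frobPow hF τ
    have := hbd j hj
    rw [frobPow_apply, hα3] at h
    have := hα.pow_inj (by omega) (by omega) h
    have h1 := hodd' j
    have h2 := (hodd' (l % m)).add_one
    rw [this] at h2
    exact (Nat.not_even_iff_odd.mpr h1) h2
  have h23 : IsCoprime (minpoly (ZMod p) (α ^ 2)) (minpoly (ZMod p) (α ^ (p ^ l + 1))) := by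
    refine isCoprime_minpoly fun τ h => ?_
    obtain ⟨j, hj, rfl⟩ := exists_eq_frobPow hF τ
    have := hbd j hj
    rw [frobPow_apply, hα3, ← pow_mul] at h
    have h1 := hα.pow_inj (by omega) (by omega) h
    have h2 : p ∣ p ^ (l % m) := dvd_pow_self p hl0
    rcases Nat.eq_zero_or_pos j with rfl | hj0
    · rw [pow_zero] at h1
      have := Nat.le_of_dvd (pow_pos hprime.pos _) h2
      omega
    · have h3 : p ∣ p ^ (l % m) + 1 := h1 ▸ (dvd_pow_self p hj0.ne').mul_left 2
      exact hprime.one_lt.ne' (Nat.dvd_one.mp ((Nat.dvd_add_right h2).mp h3))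
  refine (h13.mul_left h23).mul_dvd (h12.mul_dvd ?_ (hdvd 2)) (hdvd _)
  simpa using hdvd 1

/-- The labelling of the coordinates by the elements of the field. -/
lemma exists_equiv_labelling (hF : Fintype.card F = p ^ m) (hm : m ≠ 0)
    (hα : IsPrimitiveRoot α (p ^ m - 1)) : ∃ f : Fin (p ^ m - 1 + 1) ≃ F,
      (∀ i : Fin (p ^ m - 1), f i.castSucc = (α⁻¹) ^ (i : ℕ)) ∧ f (Fin.last _) = 0 := by
  have hp1 : 1 < p ^ m := Nat.one_lt_pow hm (Fact.out : p.Prime).one_lt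
  have hα0 : α ≠ 0 := hα.ne_zero (by omega)
  let f : Fin (p ^ m - 1 + 1) → F := Fin.snoc (α := fun _ => F)
    (fun i : Fin (p ^ m - 1) => (α⁻¹) ^ (i : ℕ)) 0
  have h1 : ∀ i : Fin (p ^ m - 1), f i.castSucc = (α⁻¹) ^ (i : ℕ) := fun i => by simp [f]
  have h2 : f (Fin.last _) = 0 := by simp [f]
  have hf : Function.Bijective f := by
    rw [Fintype.bijective_iff_injective_and_card]
    refine ⟨?_, by rw [Fintype.card_fin, hF]; omega⟩
    intro x y
    refine Fin.lastCases ?_ (fun i => ?_) x <;> refine Fin.lastCases ?_ (fun j => ?_) y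
    · simp
    · intro h
      rw [h1, h2] at h
      exact absurd h.symm (pow_ne_zero _ (inv_ne_zero hα0))
    · intro h
      rw [h1, h2] at h
      exact absurd h (pow_ne_zero _ (inv_ne_zero hα0))
    · intro h
      rw [h1, h1] at h
      rw [Fin.ext (hα.inv.pow_inj i.2 j.2 h)]
  exact ⟨Equiv.ofBijective f hf, h1, h2⟩

/-- The code is a trace code. -/
theorem exists_equiv_mem_designCode_iff (hp : p ≠ 2) (hm4 : 4 ≤ m) (hml : Nat.gcd m l = 1)
    (hF : Fintype.card F = p ^ m) (hα : orderOf α = p ^ m - 1) :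
    ∃ f : Fin (p ^ m - 1 + 1) ≃ F, ∀ w, w ∈ designCode p m l α ↔
      ∃ a b c : F, ∃ h : ZMod p, ∀ j, w j =
        Algebra.trace (ZMod p) F (a * f j ^ (p ^ l + 1) + b * f j ^ 2 + c * f j) + h := by
  have hprime : p.Prime := Fact.out
  have hprim : IsPrimitiveRoot α (p ^ m - 1) := hα ▸ IsPrimitiveRoot.orderOf α
  have hp1 : 1 < p ^ m := Nat.one_lt_pow (by omega) hprime.one_lt
  obtain ⟨f, hf1, hf2⟩ := exists_equiv_labelling hF (by omega) hprim
  have hcode : codeC₁ p m l α = traceCode (p ^ m - 1) α {1, 2, p ^ l + 1} := by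
    refine cyclicCodeOfParityCheck_eq_traceCode (by rw [hF]) (by omega) hprim
      (minpoly_mul_minpoly_mul_minpoly_dvd hp hm4 hml hF hprim) fun x => ?_
    rw [map_mul, map_mul, mul_eq_zero, mul_eq_zero, aeval_minpoly_eq_zero_iff,
      aeval_minpoly_eq_zero_iff, aeval_minpoly_eq_zero_iff]
    simp [or_assoc]
  have hpl : 1 ≤ p ^ l := Nat.one_le_pow _ _ hprime.pos
  have hpl1 : 1 ≠ p ^ l := by
    intro h
    have hl : l ≠ 0 := by rintro rfl; simp at hml; omega
    exact (Nat.one_lt_pow hl hprime.one_lt).ne h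
  refine ⟨f, fun w => ?_⟩
  rw [designCode, mem_dualCode_extendedCode_dualCode, hcode]
  have hsum : ∀ (a : ℕ → F) (x : F), ∑ e ∈ ({1, 2, p ^ l + 1} : Finset ℕ), a e * x ^ e =
      a (p ^ l + 1) * x ^ (p ^ l + 1) + a 2 * x ^ 2 + a 1 * x := by
    intro a x
    rw [sum_insert (by simp only [mem_insert, mem_singleton]; omega),
      sum_insert (by simp only [mem_singleton]; omega), sum_singleton]
    ring
  constructor
  · rintro ⟨a, ha⟩
    -- The last coordinate is labelled by 0, so its value is the constant term.
    refine ⟨a (p ^ l + 1), a 2, a 1, w (Fin.last _), fun j => ?_⟩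
    refine Fin.lastCases ?_ (fun i => ?_) j
    · rw [hf2]; simp
    · rw [hf1, ← hsum, ← ha]; ring
  · rintro ⟨a, b, c, h, hw⟩
    refine ⟨fun e => if e = 1 then c else if e = 2 then b else a, fun i => ?_⟩
    rw [hsum]
    simp only [hw, hf1, hf2]
    simp [hprime.ne_zero, show p ^ l + 1 ≠ 2 by omega]

end Frobenius

/-! ### Words with equal supports -/

section Proportional

variable {K : Type*} [Field K] [Fintype K] [DecidableEq K] {ι : Type*} [Fintype ι] [DecidableEq ι]

/-- Two words with the same zeros, the nonzero combinations of which have few zeros, are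
proportional. -/
lemma exists_eq_smul_of_card_zeros_le (C : Submodule K (ι → K)) {M : ℕ}
    (hM : ∀ c ∈ C, c ≠ 0 → #{x | c x = 0} ≤ M) {c c' : ι → K} (hc : c ∈ C) (hc' : c' ∈ C)
    (h0 : ∀ x, c x = 0 ↔ c' x = 0)
    (hlt : (Fintype.card K - 1) * M < (Fintype.card K - 1) * #{x | c x = 0} + hammingNorm c) :
    ∃ μ : K, c' = μ • c := by
  by_contra! hne
  -- Common zeros and places where `c' / c = μ` are zeros of `c' - μ • c`. Summed over `μ ≠ 0`, the
  -- places of the second sort exhaust the support of `c`.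
  have h1 : ∀ μ ∈ univ.erase (0 : K),
      #{x | c x = 0} + #{x | c x ≠ 0 ∧ c' x / c x = μ} ≤ M := by
    intro μ _
    refine le_trans ?_ (hM (c' - μ • c) (C.sub_mem hc' (C.smul_mem μ hc))
      (sub_ne_zero.mpr (hne μ)))
    rw [← card_union_of_disjoint]
    · refine card_le_card fun x hx => ?_
      simp only [mem_union, mem_filter, mem_univ, true_and, Pi.sub_apply, Pi.smul_apply,
        smul_eq_mul] at hx ⊢
      rcases hx with hx | ⟨hx, rfl⟩
      · rw [hx, (h0 x).mp hx]; simp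
      · rw [div_mul_cancel₀ _ hx, sub_self]
    · rw [disjoint_filter]
      rintro x - hx ⟨hx', -⟩
      exact hx' hx
  have h2 : hammingNorm c = ∑ μ ∈ univ.erase (0 : K), #{x | c x ≠ 0 ∧ c' x / c x = μ} := by
    rw [hammingNorm, card_eq_sum_card_fiberwise (f := fun x => c' x / c x) (t := univ.erase 0)]
    · simp_rw [filter_filter]
    · intro x hx
      have hx : c x ≠ 0 := by simpa using hx
      simp only [coe_erase, coe_univ, Set.mem_sdiff, Set.mem_univ, true_and, Set.mem_singleton_iff]
      exact div_ne_zero (fun h => hx ((h0 x).mpr h)) hx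
  have h3 := sum_le_card_nsmul _ _ _ h1
  rw [sum_add_distrib, ← h2, sum_const, card_erase_of_mem (mem_univ _), card_univ, smul_eq_mul,
    smul_eq_mul] at h3
  omega

end Proportional

/-! ### Numerical inequalities -/

section Inequalities

lemma two_lt_of_mul_eq {p N e k : ℤ} (hp : 3 ≤ p) (hN : p ^ 2 ≤ N) (he : e ≤ p * (p - 1))
    (hk : p * k = (p - 1) * (N * N) - N * e) : 2 < k := by
  have h1 : (p - 1) * p ^ 2 ≤ (p - 1) * N := mul_le_mul_of_nonneg_left hN (by omega)
  have h2 : 2 ≤ p - 1 := by omega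
  have h3 : 4 ≤ (p - 1) * (p - 1) := by nlinarith
  have h4 : p * 4 ≤ p * ((p - 1) * (p - 1)) := mul_le_mul_of_nonneg_left h3 (by omega)
  have h5 : 3 ≤ (p - 1) * N - e := by linarith
  have h6 : p * 1 ≤ N := by nlinarith
  have h7 : p * 1 * 3 ≤ N * ((p - 1) * N - e) := mul_le_mul h6 h5 (by omega) (by omega)
  have h8 : p * 3 ≤ p * k := by linarith
  have := le_of_mul_le_mul_left h8 (by omega)
  omega

/-- The criterion for proportionality after cancelling `p ^ n`. It fails for `n = 2`, `e = -p(p -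
1)`, so `he'` is needed. -/
lemma mul_sub_one_lt_of_le {p e : ℤ} {n : ℕ} (hp : 3 ≤ p) (hn : 2 ≤ n)
    (he : -(p * (p - 1)) ≤ e) (he' : n = 2 → -p ≤ e) :
    (p - 1) * (p * (p - 1)) < (p - 1) * p ^ n + (p - 2) * e := by
  rcases hn.eq_or_lt with rfl | h
  · have h1 : (p - 2) * -p ≤ (p - 2) * e := mul_le_mul_of_nonneg_left (he' rfl) (by omega)
    linarith
  · have h3 : p ^ 3 ≤ p ^ n := pow_le_pow_right₀ (by omega) h
    have h4 : (p - 1) * p ^ 3 ≤ (p - 1) * p ^ n := mul_le_mul_of_nonneg_left h3 (by omega)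
    have h5 : (p - 2) * (-(p * (p - 1))) ≤ (p - 2) * e :=
      mul_le_mul_of_nonneg_left he (by omega)
    have h6 : 0 < p * (p - 1) * (p * (p - 2) + 3) :=
      mul_pos (mul_pos (by omega) (by omega)) (by nlinarith)
    linarith

end Inequalities

/-! ### Designs in the trace code -/

section TraceCodeDesigns

variable {p : ℕ} [Fact p.Prime] {F : Type*} [Field F] [Fintype F] [Algebra (ZMod p) F]
  {ι : Type*} [Fintype ι] [DecidableEq ι]

/-- The word with parameters `v = ((a, b), c, h)`. -/
def paramWord (σ : F ≃ₐ[ZMod p] F) (f : ι ≃ F) (v : (F × F) × F × ZMod p) : ι → ZMod p :=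
  fun j => Algebra.trace (ZMod p) F (v.1.1 * (f j * σ (f j)) + v.1.2 * f j ^ 2 + v.2.1 * f j) +
    v.2.2

variable {σ : F ≃ₐ[ZMod p] F} {f : ι ≃ F}

lemma paramWord_sub (v v' : (F × F) × F × ZMod p) :
    paramWord σ f (v - v') = paramWord σ f v - paramWord σ f v' := by
  funext j
  simp only [paramWord, Prod.fst_sub, Prod.snd_sub, sub_mul, Pi.sub_apply, map_add, map_sub]
  ring

lemma card_zeros_paramWord (v : (F × F) × F × ZMod p) :
    #{j | paramWord σ f v j = 0} = zeroCount σ v.1 v.2.1 v.2.2 :=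
  card_equiv f (by simp [paramWord])

lemma hammingNorm_add_zeroCount (v : (F × F) × F × ZMod p) :
    hammingNorm (paramWord σ f v) + zeroCount σ v.1 v.2.1 v.2.2 = Fintype.card F := by
  rw [← card_zeros_paramWord (f := f), hammingNorm, add_comm,
    card_filter_add_card_filter_not, card_univ, Fintype.card_congr f]

variable {n : ℕ}

/-- Otherwise nonzero parameters would give the zero word, whose `q` zeros exceed the bound of
`mul_zeroCount_le` because `p ^ n > p`. -/
lemma paramWord_injective (hp : p ≠ 2) (hn : 2 ≤ n) (hF : Fintype.card F = p ^ (2 * n))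
    (hσ : ∀ x, σ x = x → ∃ k : ZMod p, algebraMap (ZMod p) F k = x) :
    Function.Injective (paramWord σ f) := by
  intro v v' h
  by_contra hne
  have h1 := hammingNorm_add_zeroCount (σ := σ) (f := f) (v - v')
  have h2 : paramWord σ f (v - v') = 0 := by rw [paramWord_sub, h, sub_self]
  rw [h2, hammingNorm_zero, zero_add] at h1
  have h3 := mul_zeroCount_le (σ := σ) hp (by omega) hF hσ (x := (v - v').1) (c := (v - v').2.1)
    (h := (v - v').2.2) (by
      rintro ⟨e1, e2, e3⟩
      exact hne (sub_eq_zero.mp (Prod.ext e1 (Prod.ext e2 e3))))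
  rw [h1, hF] at h3
  have hp3 : (3 : ℤ) ≤ p := by
    have := (Fact.out : p.Prime).two_le
    omega
  have h4 : (p : ℤ) ^ 2 ≤ p ^ n := pow_le_pow_right₀ (by omega) hn
  have h5 : (p : ℤ) ^ (2 * n) = p ^ n * p ^ n := by rw [two_mul, pow_add]
  push_cast at h3
  rw [h5] at h3
  have h6 : (p : ℤ) ^ n * ((p - 1) * (p ^ n - p)) ≤ 0 := by linear_combination h3
  have h7 : (0 : ℤ) < p ^ n * ((p - 1) * (p ^ n - p)) :=
    mul_pos (by positivity) (mul_pos (by omega) (by nlinarith))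
  omega

lemma exists_paramWord_affine (v : (F × F) × F × ZMod p) (r s : F) :
    ∃ v' : (F × F) × F × ZMod p, ∀ x : F,
      Algebra.trace (ZMod p) F (v.1.1 * ((r * x + s) * σ (r * x + s)) + v.1.2 * (r * x + s) ^ 2 +
        v.2.1 * (r * x + s)) + v.2.2 =
      Algebra.trace (ZMod p) F (v'.1.1 * (x * σ x) + v'.1.2 * x ^ 2 + v'.2.1 * x) + v'.2.2 := by
  obtain ⟨⟨a, b⟩, c, h⟩ := v
  -- The cross term with `σ x` is made linear in `x` by applying `σ.symm` under the trace.
  obtain ⟨y, hy⟩ : ∃ y, y = σ.symm (a * s * σ r) := ⟨_, rfl⟩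
  refine ⟨((a * r * σ r, b * r ^ 2), a * r * σ s + y + 2 * b * r * s + c * r,
    Algebra.trace (ZMod p) F (a * s * σ s + b * s ^ 2 + c * s) + h), fun x => ?_⟩
  have h1 : Algebra.trace (ZMod p) F (y * x) =
      Algebra.trace (ZMod p) F (a * s * σ r * σ x) := by
    rw [hy, ← trace_apply_algEquiv σ, map_mul, AlgEquiv.apply_symm_apply]
  simp only [add_mul, map_add, h1, map_mul]
  rw [← add_assoc, add_left_inj]
  simp only [← map_add]
  congr 1
  ring

lemma exists_perm_mem_code {C : Submodule (ZMod p) (ι → ZMod p)}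
    (hC : ∀ w, w ∈ C ↔ ∃ v, w = paramWord σ f v) (i j i' j' : ι) (hij : i ≠ j) (hij' : i' ≠ j') :
    ∃ π : Equiv.Perm ι, π i = i' ∧ π j = j' ∧ ∀ c ∈ C, (fun x => c (π x)) ∈ C := by
  have hd : f i - f j ≠ 0 := sub_ne_zero.mpr (f.injective.ne hij)
  have hd' : f i' - f j' ≠ 0 := sub_ne_zero.mpr (f.injective.ne hij')
  set r := (f i' - f j') / (f i - f j) with hr
  have hr0 : r ≠ 0 := div_ne_zero hd' hd
  have hrd : r * (f i - f j) = f i' - f j' := div_mul_cancel₀ _ hd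
  let g : F ≃ F := (Equiv.mulLeft₀ r hr0).trans (Equiv.addRight (f i' - r * f i))
  have hg : ∀ x, g x = r * x + (f i' - r * f i) := fun x => rfl
  refine ⟨(f.trans g).trans f.symm, ?_, ?_, ?_⟩
  · simp [hg]
  · simp only [Equiv.trans_apply, hg, Equiv.symm_apply_eq]
    linear_combination -hrd
  · intro c hc
    obtain ⟨v, rfl⟩ := (hC c).mp hc
    obtain ⟨v', hv'⟩ := exists_paramWord_affine (σ := σ) v r (f i' - r * f i)
    refine (hC _).mpr ⟨v', ?_⟩
    funext x
    simp only [paramWord, Equiv.trans_apply, Equiv.apply_symm_apply, hg, hv']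

/-- The codes of all words `paramWord σ f v` hold designs. -/
theorem holdsDesign_of_paramWord (hp : p ≠ 2) (hn : 2 ≤ n) (hF : Fintype.card F = p ^ (2 * n))
    (hσ : ∀ x, σ x = x → ∃ k : ZMod p, algebraMap (ZMod p) F k = x)
    {C : Submodule (ZMod p) (ι → ZMod p)} (hC : ∀ w, w ∈ C ↔ ∃ v, w = paramWord σ f v) {e : ℤ}
    (he1 : e ≤ p * (p - 1)) (he2 : -(p * (p - 1)) ≤ e) (he3 : n = 2 → -p ≤ e)
    (hA : 0 < wordCount σ n e) {i lam : ℚ}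
    (hi : p * i = (p - 1) * (p : ℚ) ^ (2 * n) - (p : ℚ) ^ n * e)
    (hlam : (wordCount σ n e : ℚ) * (i * (i - 1)) =
      lam * ((p - 1) * ((p : ℚ) ^ (2 * n) * ((p : ℚ) ^ (2 * n) - 1)))) :
    HoldsDesign C 2 (p ^ (2 * n)) i lam := by
  classical
  have hι : Fintype.card ι = p ^ (2 * n) := by rw [Fintype.card_congr f, hF]
  have hp3 : (3 : ℤ) ≤ p := by
    have := (Fact.out : p.Prime).two_le
    omega
  have hpn2 : (p : ℤ) ^ 2 ≤ p ^ n := pow_le_pow_right₀ (by omega) hn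
  have hpn0 : (0 : ℤ) < p ^ n := by positivity
  have hq : (p : ℤ) ^ (2 * n) = p ^ n * p ^ n := by rw [two_mul, pow_add]
  obtain ⟨v₀, hv₀⟩ := card_pos.mp hA
  have hv₀ := (mem_filter.mp hv₀).2
  set Z := zeroCount σ v₀.1 v₀.2.1 v₀.2.2 with hZ
  have hkZ := hammingNorm_add_zeroCount (σ := σ) (f := f) v₀
  set k := hammingNorm (paramWord σ f v₀) with hk
  rw [← hZ, hF] at hkZ
  have hkZ' : (k : ℤ) + Z = p ^ n * p ^ n := by rw [← hq]; exact_mod_cast hkZ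
  rw [hq] at hv₀
  have hpk : (p : ℤ) * k = (p - 1) * (p ^ n * p ^ n) - p ^ n * e := by
    linear_combination p * hkZ' - hv₀
  have hki : (k : ℚ) = i := by
    have h1 := congrArg (Int.cast (R := ℚ)) hpk
    push_cast at h1
    have hp0 : (p : ℚ) ≠ 0 := by exact_mod_cast (Fact.out : p.Prime).ne_zero
    refine mul_left_cancel₀ hp0 ?_
    rw [h1, hi, two_mul, pow_add]
  have hiff : ∀ v : (F × F) × F × ZMod p, hammingNorm (paramWord σ f v) = k ↔
      (p : ℤ) * zeroCount σ v.1 v.2.1 v.2.2 = p ^ (2 * n) + p ^ n * e := by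
    intro v
    have h1 := hammingNorm_add_zeroCount (σ := σ) (f := f) v
    rw [hF, ← hkZ] at h1
    rw [hq, ← hv₀, mul_right_inj' (by omega : (p : ℤ) ≠ 0)]
    omega
  have hcardA : Nat.card {c // c ∈ C ∧ hammingNorm c = k} = wordCount σ n e := by
    rw [wordCount, ← Fintype.card_subtype, ← Nat.card_eq_fintype_card]
    refine (Nat.card_congr (Equiv.ofBijective
      (fun v => ⟨paramWord σ f v.1, (hC _).mpr ⟨v.1, rfl⟩, (hiff v.1).mpr v.2⟩) ⟨?_, ?_⟩)).symm
    · intro v v' h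
      exact Subtype.ext (paramWord_injective hp hn hF hσ (congrArg Subtype.val h))
    · rintro ⟨c, hc, hck⟩
      obtain ⟨v, rfl⟩ := (hC c).mp hc
      exact ⟨⟨v, (hiff v).mp hck⟩, rfl⟩
  have hk2 : 2 < k := by exact_mod_cast two_lt_of_mul_eq hp3 hpn2 he1 hpk
  have hkv : k < Fintype.card ι := by
    rw [hι, ← hkZ]
    have h1 : 0 < (p : ℤ) * Z := by
      rw [hv₀]
      have : 0 < (p : ℤ) ^ n * (p ^ n + e) := mul_pos hpn0 (by linarith)
      linarith
    have := pos_of_mul_pos_right h1 (by omega)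
    omega
  have hsame : ∀ c ∈ C, ∀ c' ∈ C, hammingNorm c = k → (∀ x, c x = 0 ↔ c' x = 0) →
      ∃ μ : ZMod p, c' = μ • c := by
    intro c hc c' hc' hck h0
    -- The bound of `mul_zeroCount_le` on the zeros of a nonzero word, divided by `p`.
    obtain ⟨M, hM⟩ : ∃ M : ℕ, (M : ℤ) = p ^ (n - 1) * (p ^ n + p * (p - 1)) :=
      ⟨(p ^ (n - 1) * (p ^ n + p * (p - 1)) : ℤ).toNat, Int.toNat_of_nonneg
        (mul_nonneg (by positivity) (add_nonneg (by positivity)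
          (mul_nonneg (by omega) (by omega))))⟩
    have hpM : (p : ℤ) * M = p ^ n * p ^ n + p ^ n * (p * (p - 1)) := by
      have : (p : ℤ) * p ^ (n - 1) = p ^ n := by rw [← pow_succ']; congr 1; omega
      rw [hM, ← mul_assoc, this]; ring
    refine exists_eq_smul_of_card_zeros_le C (M := M) ?_ hc hc' h0 ?_
    · intro w hw hw0
      obtain ⟨v, rfl⟩ := (hC w).mp hw
      rw [card_zeros_paramWord]
      have h1 := mul_zeroCount_le (σ := σ) hp (by omega) hF hσ (x := v.1) (c := v.2.1)
        (h := v.2.2) (by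
          rintro ⟨e1, e2, e3⟩
          refine hw0 ?_
          funext j
          simp [paramWord, e1, e2, e3])
      rw [hq, ← hpM] at h1
      exact_mod_cast le_of_mul_le_mul_left h1 (by omega)
    · obtain ⟨v, rfl⟩ := (hC c).mp hc
      have h1 := hammingNorm_add_zeroCount (σ := σ) (f := f) v
      rw [hck, hF, ← hkZ] at h1
      rw [card_zeros_paramWord, hck, Nat.add_left_cancel h1, ZMod.card]
      zify [(Fact.out : p.Prime).one_le]
      refine lt_of_mul_lt_mul_left (a := (p : ℤ)) ?_ (by omega)
      have h2 : (p : ℤ) ^ n * ((p - 1) * (p * (p - 1))) <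
          p ^ n * ((p - 1) * p ^ n + (p - 2) * e) :=
        mul_lt_mul_of_pos_left (mul_sub_one_lt_of_le hp3 hn he2 he3) hpn0
      linear_combination h2 + (p - 1) * hpM - (p - 1) * hv₀ - hpk
  have := holdsDesign_of_doublyTransitive C hk2 hkv hcardA hA (exists_perm_mem_code hC) hsame hki (lam := lam) (by
    rw [hlam, hι, ZMod.card]; push_cast; rfl)
  rwa [hι] at this

end TraceCodeDesigns

/-! ### The nine parameter pairs -/

section Parameters

variable {p : ℕ} [Fact p.Prime] {F : Type*} [Field F] [Fintype F] [Algebra (ZMod p) F]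
  {ι : Type*} [Fintype ι] [DecidableEq ι] {σ : F ≃ₐ[ZMod p] F} {f : ι ≃ F} {n : ℕ}

/-- This makes each listed weight occur. The hypothesis `n ≥ 2` matters: for `p ^ (n - 1) = 1` the
formula for corank two and type `-1` gives zero. -/
lemma kindCount_pos (hp : p ≠ 2) (hn : 2 ≤ n) (hF : Fintype.card F = p ^ (2 * n))
    (hσ : ∀ x, σ x = x → ∃ k : ZMod p, algebraMap (ZMod p) F k = x) (ε : ℤˣ) :
    (0 : ℚ) < kindCount σ n (0, ε) ∧ (0 : ℚ) < kindCount σ n (1, 1) + kindCount σ n (1, -1) ∧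
      (0 : ℚ) < kindCount σ n (2, ε) := by
  obtain ⟨h0, h1, h2⟩ := kindCount_eq hp (by omega) hF hσ rfl rfl
  have hp3 : (3 : ℚ) ≤ p := by
    have := (Fact.out : p.Prime).two_le
    exact_mod_cast (by omega : 3 ≤ p)
  obtain ⟨s, hs⟩ : ∃ s : ℚ, s = p ^ (n - 1) := ⟨_, rfl⟩
  rw [← hs] at h0 h1 h2
  have hsp : (p : ℚ) ≤ s := by
    rw [hs]; exact le_self_pow₀ (by linarith) (by omega)
  have hss : s * 3 ≤ s * s := mul_le_mul_of_nonneg_left (by linarith) (by linarith)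
  have hpp : (p : ℚ) * 3 ≤ p * p := mul_le_mul_of_nonneg_left hp3 (by linarith)
  have hq : (0 : ℚ) < p ^ 2 * s ^ 2 - 1 := by nlinarith
  have hd : (0 : ℚ) < 2 * (p ^ 2 - 1) := by nlinarith
  have hpss : (p : ℚ) * s * 3 ≤ p * s * s :=
    mul_le_mul_of_nonneg_left (by linarith) (mul_nonneg (by linarith) (by linarith))
  have hps3 : s * 3 ≤ p * s := by nlinarith
  have hps : 9 ≤ (p : ℚ) * s := by nlinarith
  have hε : ((ε : ℤ) : ℚ) = 1 ∨ ((ε : ℤ) : ℚ) = -1 := by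
    rcases Int.units_eq_one_or ε with rfl | rfl <;> simp
  refine ⟨?_, ?_, ?_⟩
  · refine pos_of_mul_pos_right (a := 2 * ((p : ℚ) ^ 2 - 1)) ?_ hd.le
    rw [h0]
    refine mul_pos hq ?_
    have h3 : (0 : ℚ) < s ^ 2 * (p ^ 2 - p - 1) - (p - 1) * s + 1 := by
      have h4 : s * (p - 1) ≤ s ^ 2 * (p ^ 2 - p - 1) :=
        mul_le_mul (by nlinarith) (by nlinarith) (by linarith) (by positivity)
      linarith
    have h5 : (0 : ℚ) < p ^ 2 * (s ^ 2 * (p ^ 2 - p - 1) - (p - 1) * s + 1) :=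
      mul_pos (by positivity) h3
    have h6 : (0 : ℚ) ≤ p ^ 2 * ((p - 1) * s) :=
      mul_nonneg (by positivity) (mul_nonneg (by linarith) (by linarith))
    rcases hε with h | h <;> rw [h] <;> linarith
  · rw [h1]
    exact mul_pos (mul_pos (by linarith) (by nlinarith)) hq
  · refine pos_of_mul_pos_right (a := 2 * ((p : ℚ) ^ 2 - 1)) ?_ hd.le
    rw [h2]
    refine mul_pos hq ?_
    rcases hε with h | h <;> rw [h] <;> linarith

/-- The code of all words `paramWord σ f v` holds designs with the parameters in the list. -/
theorem holdsDesign_of_mem_designParameters (hp : p ≠ 2) (hn : 2 ≤ n)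
    (hF : Fintype.card F = p ^ (2 * n))
    (hσ : ∀ x, σ x = x → ∃ k : ZMod p, algebraMap (ZMod p) F k = x)
    {C : Submodule (ZMod p) (ι → ZMod p)} (hC : ∀ w, w ∈ C ↔ ∃ v, w = paramWord σ f v) :
    (∀ r ∈ (designParameters p (2 * n)).take 8, HoldsDesign C 2 (p ^ (2 * n)) r.1 r.2) ∧
    (3 ≤ n → ∀ r ∈ (designParameters p (2 * n)).drop 8,
      HoldsDesign C 2 (p ^ (2 * n)) r.1 r.2) := by
  have hp3 : 3 ≤ p := by
    have := (Fact.out : p.Prime).two_le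
    omega
  have hpZ : (3 : ℤ) ≤ p := by exact_mod_cast hp3
  have hpQ : (3 : ℚ) ≤ p := by exact_mod_cast hp3
  have hpp : (p : ℤ) * 2 ≤ p * (p - 1) := mul_le_mul_of_nonneg_left (by omega) (by omega)
  have hd : (2 * (p ^ 2 - 1) : ℚ) ≠ 0 := by nlinarith
  have hp0 : (p : ℚ) ≠ 0 := by linarith
  have hp1 : (0 : ℚ) < p - 1 := by linarith
  -- The smallest power in the formulas is `t = p ^ (n - 2)`; in terms of `p` and `t` they become
  -- polynomial identities.
  obtain ⟨k, rfl⟩ : ∃ k, n = k + 2 := ⟨n - 2, by omega⟩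
  obtain ⟨t, ht⟩ : ∃ t : ℚ, t = p ^ k := ⟨_, rfl⟩
  have hq : (p ^ 4 * t ^ 2 : ℚ) = p ^ (2 * (k + 2)) := by rw [ht]; ring
  have hs : (p : ℚ) ^ (k + 2) = p ^ 2 * t := by rw [ht]; ring
  have ht0 : 0 < t := by rw [ht]; positivity
  have hq1 : (0 : ℚ) < p ^ 4 * t ^ 2 - 1 := by
    rw [hq, sub_pos]; exact one_lt_pow₀ (by linarith) (by omega)
  have hqp : (p ^ 4 * t ^ 2 / p : ℚ) = p ^ 3 * t ^ 2 := by field_simp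
  have hqp2 : (p ^ 4 * t ^ 2 / p ^ 2 : ℚ) = p ^ 2 * t ^ 2 := by field_simp
  obtain ⟨c0, c1, c2⟩ := kindCount_eq hp (by omega) hF hσ (s := p * t) (q := p ^ 4 * t ^ 2)
    (by rw [ht, show k + 2 - 1 = k + 1 by omega]; ring) (by ring)
  have hw := fun ε => wordCount_eq hp hn hF hσ hq ε
  have hpos := kindCount_pos hp hn hF hσ
  have a1 := c0 1
  have a2 := c0 (-1)
  have b1 := c2 1
  have b2 := c2 (-1)
  simp only [hqp, hqp2] at hw
  obtain ⟨w1, w2, w3, w4, w5⟩ := hw 1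
  obtain ⟨w1', w2', w3', w4', -⟩ := hw (-1)
  obtain ⟨z0, z1, z2⟩ := hpos 1
  obtain ⟨z0', -, z2'⟩ := hpos (-1)
  simp only [Units.val_neg, Units.val_one, Int.cast_neg, Int.cast_one, one_mul, neg_mul, neg_neg]
    at a1 a2 b1 b2 w1 w2 w3 w4 w1' w2' w3' w4'
  generalize (kindCount σ (k + 2) (0, 1) : ℚ) = x at *
  generalize (kindCount σ (k + 2) (0, -1) : ℚ) = x' at *
  generalize (kindCount σ (k + 2) (1, 1) + kindCount σ (k + 2) (1, -1) : ℚ) = y at *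
  generalize (kindCount σ (k + 2) (2, 1) : ℚ) = z at *
  generalize (kindCount σ (k + 2) (2, -1) : ℚ) = z' at *
  have e1 : (p : ℚ) ^ (2 * (k + 2)) = (p : ℚ) ^ 4 * t ^ 2 := by rw [ht]; ring
  have e2 : (p : ℚ) ^ (2 * (k + 2) - 1) = (p : ℚ) ^ 3 * t ^ 2 := by
    rw [ht, show 2 * (k + 2) - 1 = 2 * k + 3 by omega]; ring
  have e3 : (p : ℚ) ^ (2 * (k + 2) - 2) = (p : ℚ) ^ 2 * t ^ 2 := by
    rw [ht, show 2 * (k + 2) - 2 = 2 * k + 2 by omega]; ring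
  have e4 : (p : ℚ) ^ (2 * (k + 2) + 2) = (p : ℚ) ^ 6 * t ^ 2 := by rw [ht]; ring
  have e5 : (p : ℚ) ^ (2 * (2 * (k + 2)) - 1) = (p : ℚ) ^ 7 * t ^ 4 := by
    rw [ht, show 2 * (2 * (k + 2)) - 1 = 4 * k + 7 by omega]; ring
  have e6 : (p : ℚ) ^ (2 * (2 * (k + 2)) - 2) = (p : ℚ) ^ 6 * t ^ 4 := by
    rw [ht, show 2 * (2 * (k + 2)) - 2 = 4 * k + 6 by omega]; ring
  have e7 : (p : ℚ) ^ (2 * (2 * (k + 2)) - 3) = (p : ℚ) ^ 5 * t ^ 4 := by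
    rw [ht, show 2 * (2 * (k + 2)) - 3 = 4 * k + 5 by omega]; ring
  have e8 : 2 * (k + 2) / 2 = k + 2 := by omega
  have e9 : (p : ℚ) ^ (k + 2) = (p : ℚ) ^ 2 * t := by rw [ht]; ring
  have e10 : (p : ℚ) ^ (k + 2 - 1) = p * t := by
    rw [ht, show k + 2 - 1 = k + 1 by omega]; ring
  have e11 : (p : ℚ) ^ (k + 2 + 1) = (p : ℚ) ^ 3 * t := by rw [ht]; ring
  have e12 : (p : ℚ) ^ (k + 2 - 2) = t := by rw [ht, show k + 2 - 2 = k by omega]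
  simp only [designParameters, e1, e2, e3, e4, e5, e6, e7, e8, e9, e10, e11, e12, List.take_succ_cons, List.take_zero, List.drop_succ_cons, List.drop_zero,
    List.forall_mem_cons, List.not_mem_nil, false_implies, implies_true, and_true]
  -- The deviation `e` of each pair is read off from `p i = (p - 1) q - p ^ n e`. Only the last one,
  -- `-p(p - 1)`, is below `-p`, and there `hk` is used.
  refine ⟨⟨?_, ?_, ?_, ?_, ?_, ?_, ?_, ?_⟩, fun hk => ?_⟩
  · refine holdsDesign_of_paramWord hp hn hF hσ hC (e := 0) (by omega) (by omega) (by omega)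
      (Nat.cast_pos (α := ℚ).mp ?_) (by rw [hs, ← hq]; push_cast; ring) ?_
    · have h1 : (0 : ℚ) < p ^ 4 * t ^ 2 - p ^ 3 * t ^ 2 := by
        have : 0 < p ^ 3 * t ^ 2 * (p - 1) := by positivity
        linarith
      have h2 : (0 : ℚ) < p ^ 4 * t ^ 2 - p ^ 2 * t ^ 2 := by
        have : 0 < p ^ 3 * t ^ 2 * (p - 1) + p ^ 2 * t ^ 2 * (p - 1) := by positivity
        linarith
      rw [w5]
      positivity
    · rw [w5, ← hq]
      refine mul_left_cancel₀ hd ?_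
      linear_combination (p ^ 4 * t ^ 2 - p ^ 3 * t ^ 2) * (p ^ 4 * t ^ 2 - p ^ 3 * t ^ 2 - 1) *
        (2 * (p ^ 2 - 1) * (p ^ 3 * t ^ 2 + (p ^ 4 * t ^ 2 - p ^ 3 * t ^ 2) * p) * c1 +
          (p ^ 4 * t ^ 2 - p ^ 2 * t ^ 2) * p * (b1 + b2))
  · refine holdsDesign_of_paramWord hp hn hF hσ hC (e := -(p - 1)) (by omega) (by omega) (by omega)
      (Nat.cast_pos (α := ℚ).mp (by rw [w1']; positivity)) (by rw [hs, ← hq]; push_cast; ring) ?_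
    rw [w1', ← hq, div_mul_eq_mul_div, eq_div_iff hd]
    linear_combination (p ^ 4 * t ^ 2 - p ^ 3 * t ^ 2 + p ^ 2 * t - p * t) * (p ^ 4 * t ^ 2 - p ^ 3 * t ^ 2 + p ^ 2 * t - p * t - 1) *
      (p ^ 4 * t ^ 2) * a2
  · refine holdsDesign_of_paramWord hp hn hF hσ hC (e := p - 1) (by omega) (by omega) (by omega)
      (Nat.cast_pos (α := ℚ).mp (by rw [w1]; positivity)) (by rw [hs, ← hq]; push_cast; ring) ?_
    rw [w1, ← hq, div_mul_eq_mul_div, eq_div_iff hd]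
    linear_combination (p ^ 4 * t ^ 2 - p ^ 3 * t ^ 2 - p ^ 2 * t + p * t) * (p ^ 4 * t ^ 2 - p ^ 3 * t ^ 2 - p ^ 2 * t + p * t - 1) *
      (p ^ 4 * t ^ 2) * a1
  · refine holdsDesign_of_paramWord hp hn hF hσ hC (e := p * (p - 1)) (by omega) (by omega) (by omega)
      (Nat.cast_pos (α := ℚ).mp (by rw [w3]; positivity)) (by rw [hs, ← hq]; push_cast; ring) ?_
    rw [w3, ← hq, div_mul_eq_mul_div, eq_div_iff hd]
    linear_combination (p ^ 4 * t ^ 2 - p ^ 3 * t ^ 2 - p ^ 3 * t + p ^ 2 * t) * (p ^ 4 * t ^ 2 - p ^ 3 * t ^ 2 - p ^ 3 * t + p ^ 2 * t - 1) *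
      (p ^ 2 * t ^ 2) * b1
  · refine holdsDesign_of_paramWord hp hn hF hσ hC (e := -1) (by omega) (by omega) (by omega)
      (Nat.cast_pos (α := ℚ).mp (by rw [w2]; positivity)) (by rw [hs, ← hq]; push_cast; ring) ?_
    rw [w2, ← hq, div_mul_eq_mul_div, eq_div_iff hd]
    linear_combination (p ^ 4 * t ^ 2 - p ^ 3 * t ^ 2 + p * t) * (p ^ 4 * t ^ 2 - p ^ 3 * t ^ 2 + p * t - 1) *
      (p ^ 4 * t ^ 2 * (p - 1)) * a1
  · refine holdsDesign_of_paramWord hp hn hF hσ hC (e := -p) (by omega) (by omega) (by omega)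
      (Nat.cast_pos (α := ℚ).mp (by rw [w4]; positivity)) (by rw [hs, ← hq]; push_cast; ring) ?_
    rw [w4, ← hq, div_mul_eq_mul_div, eq_div_iff hd]
    linear_combination (p ^ 4 * t ^ 2 - p ^ 3 * t ^ 2 + p ^ 2 * t) * (p ^ 4 * t ^ 2 - p ^ 3 * t ^ 2 + p ^ 2 * t - 1) *
      (p ^ 2 * t ^ 2 * (p - 1) * b1 + p ^ 3 * t ^ 2 * (p - 1) * (p ^ 2 - 1) * c1)
  · refine holdsDesign_of_paramWord hp hn hF hσ hC (e := 1) (by omega) (by omega) (by omega)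
      (Nat.cast_pos (α := ℚ).mp (by rw [w2']; positivity)) (by rw [hs, ← hq]; push_cast; ring) ?_
    rw [w2', ← hq, div_mul_eq_mul_div, eq_div_iff hd]
    linear_combination (p ^ 4 * t ^ 2 - p ^ 3 * t ^ 2 - p * t) * (p ^ 4 * t ^ 2 - p ^ 3 * t ^ 2 - p * t - 1) *
      (p ^ 4 * t ^ 2 * (p - 1)) * a2
  · refine holdsDesign_of_paramWord hp hn hF hσ hC (e := p) (by omega) (by omega) (by omega)
      (Nat.cast_pos (α := ℚ).mp (by rw [w4']; positivity)) (by rw [hs, ← hq]; push_cast; ring) ?_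
    rw [w4', ← hq, div_mul_eq_mul_div, eq_div_iff hd]
    linear_combination (p ^ 4 * t ^ 2 - p ^ 3 * t ^ 2 - p ^ 2 * t) * (p ^ 4 * t ^ 2 - p ^ 3 * t ^ 2 - p ^ 2 * t - 1) *
      (p ^ 2 * t ^ 2 * (p - 1) * b2 + p ^ 3 * t ^ 2 * (p - 1) * (p ^ 2 - 1) * c1)
  · refine holdsDesign_of_paramWord hp hn hF hσ hC (e := -(p * (p - 1))) (by omega) (by omega) (by omega)
      (Nat.cast_pos (α := ℚ).mp (by rw [w3']; positivity)) (by rw [hs, ← hq]; push_cast; ring) ?_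
    rw [w3', ← hq, div_mul_eq_mul_div, eq_div_iff hd]
    linear_combination (p ^ 4 * t ^ 2 - p ^ 3 * t ^ 2 + p ^ 2 * t * (p - 1)) * (p ^ 4 * t ^ 2 - p ^ 3 * t ^ 2 + p ^ 2 * t * (p - 1) - 1) *
      (p ^ 2 * t ^ 2) * b2

end Parameters
end

theorem theorem4p4 (p m l : ℕ) [Fact p.Prime] (hp : p ≠ 2) (hm : Even m) (hm4 : 4 ≤ m)
    (hl : 1 ≤ l) (hml : Nat.gcd m l = 1)
    {F : Type*} [Field F] [Fintype F] [Algebra (ZMod p) F] (hF : Fintype.card F = p ^ m)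
    (α : F) (hα : orderOf α = p ^ m - 1) :
    -- up to labelling the coordinates by the elements of the field, the code is the trace code
    (∃ e : Fin (p ^ m - 1 + 1) ≃ F, ∀ w : Fin (p ^ m - 1 + 1) → ZMod p,
      w ∈ designCode p m l α ↔ (fun x => w (e.symm x)) ∈ traceWords F p l) ∧
    (6 ≤ m → ∀ q ∈ designParameters p m, HoldsDesign (designCode p m l α) 2 (p ^ m) q.1 q.2) ∧
    (m = 4 → ∀ q ∈ (designParameters p m).take 8,
      HoldsDesign (designCode p m l α) 2 (p ^ m) q.1 q.2) := by
  obtain ⟨n, rfl⟩ := hm.two_dvd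
  have hn : 2 ≤ n := by omega
  obtain ⟨f, hf⟩ := exists_equiv_mem_designCode_iff hp hm4 hml hF hα
  have hC : ∀ w, w ∈ designCode p (2 * n) l α ↔ ∃ v, w = paramWord (frobPow p F l) f v := by
    intro w
    rw [hf]
    constructor
    · rintro ⟨a, b, c, h, hw⟩
      refine ⟨((a, b), c, h), funext fun j => ?_⟩
      rw [hw, paramWord, frobPow_apply, pow_succ']
    · rintro ⟨⟨⟨a, b⟩, c, h⟩, rfl⟩
      exact ⟨a, b, c, h, fun j => by simp only [paramWord, frobPow_apply, pow_succ' _ (p ^ l)]⟩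
  obtain ⟨h8, h9⟩ := holdsDesign_of_mem_designParameters hp hn hF
    (exists_algebraMap_eq_of_frobPow_eq hF hml) hC
  refine ⟨⟨f, fun w => ?_⟩, fun hm6 q hq => ?_, fun _ => h8⟩
  · rw [hf]
    refine exists_congr fun a => exists_congr fun b => exists_congr fun c => exists_congr fun h =>
      ⟨fun hw x => ?_, fun hw j => ?_⟩
    · simp only [hw, f.apply_symm_apply]
    · simpa only [f.symm_apply_apply] using hw (f j)
  · rw [← List.take_append_drop 8 (designParameters p (2 * n)), List.mem_append] at hq
    exact hq.elim (h8 q) (h9 (by omega) q)
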